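/- **Setting.** Let $y=X\beta^*+w$ with a fixed design $X\in\mathbb R^{n\times p}$ ($n\ge 1$), noise $w\sim\mathcal N(0,\sigma^2 I_n)$, $\sigma\ge 0$, and $\beta^*\in\mathbb R^p$ with support $S=\{j:\beta^*_j\neq 0\}$, $s=|S|$; the signs of the nonzero components are arbitrary. Let $$S_1=\Big\{j\in S:|\beta^*_j|\ge 2\sigma\log p\,\sqrt{\tfrac{\log p}{n}}\Big\},\qquad S_2=\Big\{j\in S:|\beta^*_j|\le 2\sigma\sqrt{\tfrac{\log p}{n}}\Big\}$$ be the sets of strong and weak signals, $s_1=|S_1|\ge 1$, $s_2=|S_2|$. Let $m$ be the $s_1$-th largest value among the $|\beta_j^*|$, and $\kappa=\max_j|\beta^*_j|/m$. The matrix $X$ satisfies the $(k,\delta)$-restricted isometry property (RIP) if $(1-\delta)\|u\|^2\le n^{-1}\|Xu\|^2\le(1+\delta)\|u\|^2$ for all $u\in\mathbb R^p$ with at most $k$ nonzero components ($\|\cdot\|$ is the Euclidean norm). Gradient descent with step size $\eta$ on $f(g,l)=(2n)^{-1}\|X(g\circ l)-y\|^2$ ($\circ$ is the componentwise product) is run from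 $g_0=\alpha\mathbf 1$, $l_0=0$: $$g_{t+1}=g_t-\eta\, l_t\circ\big[n^{-1}X^T(X(g_t\circ l_t)-y)\big],\qquad l_{t+1}=l_t-\eta\, g_t\circ\big[n^{-1}X^T(X(g_t\circ l_t)-y)\big],$$ and $\beta_t=g_t\circ l_t$. For $M\ge 1$ put $$\epsilon=\max\Big\{\alpha^2,\ \sigma^2\frac{Ms_1}{n},\ \sigma^2\frac{s_2\log p}{n}\Big\},\qquad \tau=\max\Big\{\delta\alpha,\ \sigma\sqrt{\frac{\log p}{n}}\Big\}.$$ **Theorem.** For every $K>0$ there are positive constants $c_0,\tilde c_1,\dots,\tilde c_5$, depending only on $K$, such that the following holds for all $n,p,X,\beta^*,\sigma,\delta,\alpha,\eta$ and all $M\ge 1$. Assume * (A) $s=s_1+s_2$ and $\kappa m\le K$; * (B) $X$ satisfies the $(s+1,\delta)$-RIP with $\delta\le c_0/(\kappa\sqrt s\,\log\frac p\alpha)$; * (C) $0<\alpha\le c_0/p$ and $0<\eta\le c_0/(\kappa\log\frac p\alpha)$. Then for every integer $t\ge 0$ with $$\tilde c_1\,\frac{\log(p/\alpha)}{\eta m}\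 \le\ t\ \le\ \frac{\tilde c_2}{\eta\tau}$$ (the right-hand side is $+\infty$ if $\tau=0$), with probability at least $1-p^{-\tilde c_4}-e^{-\tilde c_5Ms}$, $$\|\beta_t-\beta^*\|^2\le \tilde c_3\,\epsilon .$$ -/

import Mathlib

open MeasureTheory ProbabilityTheory
open scoped Matrix

namespace HadamardGD

noncomputable section

/-- Euclidean norm of a vector in `ℝᵏ`, given by its coordinates. -/
def l2norm {k : ℕ} (v : Fin k → ℝ) : ℝ := ‖WithLp.toLp 2 v‖

/-- Index set of the nonzero components of `b`. -/
def supp {p : ℕ} (b : Fin p → ℝ) : Finset (Fin p) := {i | b i ≠ 0}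

/-- Strong signals: nonzero components with `|bᵢ| ≥ 2 σ log p √(log p / n)`. -/
def strong {p : ℕ} (n : ℕ) (σ : ℝ) (b : Fin p → ℝ) : Finset (Fin p) :=
  {i ∈ supp b | 2 * σ * Real.log p * √(Real.log p / n) ≤ |b i|}

/-- Weak signals: nonzero components with `|bᵢ| ≤ 2 σ √(log p / n)`. -/
def weak {p : ℕ} (n : ℕ) (σ : ℝ) (b : Fin p → ℝ) : Finset (Fin p) :=
  {i ∈ supp b | |b i| ≤ 2 * σ * √(Real.log p / n)}

/-- The `k`-th largest absolute component value of `b` (for `1 ≤ k ≤ p`): the largest real `x` such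
that at least `k` components have absolute value at least `x`. -/
def theta {p : ℕ} (k : ℕ) (b : Fin p → ℝ) : ℝ :=
  sSup {x : ℝ | k ≤ (Finset.univ.filter fun i => x ≤ |b i|).card}

/-- `m`: the minimal strength of the strong signals, the `s₁`-th largest absolute value in `b`. -/
def minStrong {p : ℕ} (n : ℕ) (σ : ℝ) (b : Fin p → ℝ) : ℝ :=
  theta (strong n σ b).card b

/-- `κ`: ratio of the largest absolute signal value to the smallest strong signal. -/
def kappa {p : ℕ} (n : ℕ) (σ : ℝ) (b : Fin p → ℝ) : ℝ :=
  theta 1 b / minStrong n σ b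

/-- The `(k, δ)`-restricted isometry property. -/
def RIP {n p : ℕ} (X : Matrix (Fin n) (Fin p) ℝ) (k : ℕ) (δ : ℝ) : Prop :=
  ∀ u : Fin p → ℝ, (supp u).card ≤ k →
    (1 - δ) * l2norm u ^ 2 ≤ (1 / n : ℝ) * l2norm (X *ᵥ u) ^ 2 ∧
      (1 / n : ℝ) * l2norm (X *ᵥ u) ^ 2 ≤ (1 + δ) * l2norm u ^ 2

/-- The loss `f(g, l) = (2n)⁻¹ ‖X (g ∘ l) - y‖²`. -/
def loss {n p : ℕ} (X : Matrix (Fin n) (Fin p) ℝ) (y : Fin n → ℝ) (g l : Fin p → ℝ) : ℝ :=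
  1 / (2 * n) * l2norm (X *ᵥ (g * l) - y) ^ 2

/-- `n⁻¹ Xᵀ (X β - y)`. -/
def residGrad {n p : ℕ} (X : Matrix (Fin n) (Fin p) ℝ) (y : Fin n → ℝ) (β : Fin p → ℝ) :
    Fin p → ℝ :=
  (1 / n : ℝ) • (Xᵀ *ᵥ (X *ᵥ β - y))

/-- `∇_g f = l ∘ n⁻¹ Xᵀ (X (g ∘ l) - y)`, coordinatewise. -/
theorem hasDerivAt_loss_left {n p : ℕ} (X : Matrix (Fin n) (Fin p) ℝ) (y : Fin n → ℝ)
    (g l : Fin p → ℝ) (j : Fin p) :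
    HasDerivAt (fun x => loss X y (Function.update g j x) l)
      ((l * residGrad X y (g * l)) j) (g j) := by
  have h1 : ∀ i : Fin n, HasDerivAt
      (fun x => (X *ᵥ (Function.update g j x * l) - y) i) (X i j * l j) (g j) := by
    intro i
    have h : (fun x => (X *ᵥ (Function.update g j x * l) - y) i) =
        fun x => (x - g j) * (X i j * l j) + (X *ᵥ (g * l) - y) i := by
      funext x
      have : Function.update g j x * l = g * l + Pi.single j ((x - g j) * l j) := by
        funext k
        by_cases hk : k = j
        · subst hk; simp; ring
        · simp [hk]
      rw [this, Matrix.mulVec_add]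
      simp [Matrix.mulVec_single]
      ring
    rw [h]
    simpa using (((hasDerivAt_id (g j)).sub_const (g j)).mul_const (X i j * l j)).add_const
      ((X *ᵥ (g * l) - y) i)
  have h2 := (HasDerivAt.fun_sum (u := Finset.univ) fun i _ => (h1 i).pow 2).const_mul
    (1 / (2 * n) : ℝ)
  have e : (fun x => loss X y (Function.update g j x) l) = fun x => (1 / (2 * n) : ℝ) *
      ∑ i, ((fun x => (X *ᵥ (Function.update g j x * l) - y) i) ^ 2) x := by
    funext x
    simp [loss, l2norm, EuclideanSpace.norm_sq_eq]
  rw [e]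
  refine h2.congr_deriv ?_
  simp only [Function.update_eq_self, residGrad, Pi.mul_apply, Pi.smul_apply, smul_eq_mul,
    Matrix.mulVec, dotProduct, Matrix.transpose_apply, Finset.mul_sum]
  refine Finset.sum_congr rfl fun i _ => ?_
  simp only [Pi.sub_apply, Nat.cast_ofNat, Nat.add_one_sub_one, pow_one]
  ring

/-- `∇_l f = g ∘ n⁻¹ Xᵀ (X (g ∘ l) - y)`, coordinatewise. -/
theorem hasDerivAt_loss_right {n p : ℕ} (X : Matrix (Fin n) (Fin p) ℝ) (y : Fin n → ℝ)
    (g l : Fin p → ℝ) (j : Fin p) :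
    HasDerivAt (fun x => loss X y g (Function.update l j x))
      ((g * residGrad X y (g * l)) j) (l j) := by
  have h := hasDerivAt_loss_left X y l g j
  simpa [loss, mul_comm] using h

/-- The iterates `(g_t, l_t)` of gradient descent on `loss` with step size `η`, started from
`g₀ = α 𝟏`, `l₀ = 0`. -/
def gd {n p : ℕ} (X : Matrix (Fin n) (Fin p) ℝ) (y : Fin n → ℝ) (α η : ℝ) :
    ℕ → (Fin p → ℝ) × (Fin p → ℝ)
  | 0 => (fun _ => α, fun _ => 0)
  | t + 1 =>
    let g := (gd X y α η t).1
    let l := (gd X y α η t).2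
    (g - η • (l * residGrad X y (g * l)), l - η • (g * residGrad X y (g * l)))

/-- `β_t = g_t ∘ l_t`. -/
def betaIter {n p : ℕ} (X : Matrix (Fin n) (Fin p) ℝ) (y : Fin n → ℝ) (α η : ℝ) (t : ℕ) :
    Fin p → ℝ :=
  (gd X y α η t).1 * (gd X y α η t).2

/-- The law `N(0, σ² I)` on `ℝⁿ`. -/
def noiseLaw (n : ℕ) (σ : ℝ) : Measure (Fin n → ℝ) :=
  Measure.pi fun _ => gaussianReal 0 (Real.toNNReal (σ ^ 2))

end

end HadamardGD

/-! Fix a coordinate with target `b` and let `G` be its entry of `n⁻¹Xᵀ(Xβ - y)`. One step moves the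
product `gl` towards `b` at a rate close to `η(g² + l²)`, up to the deviation `G - (gl - b)`. The
rate depends on the current size. At the start it is `ηα²`, so a coordinate with a weak drive stays
at scale `α²`. On a strong coordinate, with `ς` the sign of `b`, the quantity `g + ςl` grows by a
factor at least `1 + ηm/4` per step until `gl` reaches `b/2`; from then on the rate is at least
`ηm/2` and the error contracts. The time window is long enough for the strong coordinates to finish
and short enough for all others to remain negligible. The final error is then essentially the noise
on the strong coordinates plus the untouched weak signals.

The coordinates are coupled only through `n⁻¹XᵀX - I`, which RIP makes small entrywise
(`RIP.abs_gram_add_sub_le`): a sparse error enters through its ℓ² norm, the small dense remainder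
through its ℓ¹ norm. Hence the deviation is the effective noise `n⁻¹Xᵀw`, a fixed leakage `F`, and a
small fraction of the strong error still present. `Regime` collects what is needed, `Inv` is the
induction hypothesis, `Regime.inv_succ` propagates it, and `Regime.l2norm_sub_le` reads off the
error.

Randomness enters only through the effective noise. RIP bounds its covariance on small sets of
coordinates, and a Gaussian exponential moment gives `RIP.effNoise_good`. `error_le` checks that the
hypotheses of the theorem produce a `Regime` on that event. -/

namespace HadamardGD

/-! ### Tail bound for quadratic forms of a standard Gaussian vector. -/

section Gaussian

variable {ι κ : Type*} [Fintype ι] [Fintype κ]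

theorem lintegral_pi_exp_sum (μ : ι → Measure ℝ) [∀ i, IsProbabilityMeasure (μ i)]
    (f : ι → ℝ → ℝ) (hf : ∀ i, Integrable (fun x => Real.exp (f i x)) (μ i)) :
    ∫⁻ z, ENNReal.ofReal (Real.exp (∑ i, f i (z i))) ∂Measure.pi μ =
      ENNReal.ofReal (∏ i, ∫ x, Real.exp (f i x) ∂μ i) := by
  simp_rw [Real.exp_sum]
  rw [← integral_fintype_prod_eq_prod (fun i x => Real.exp (f i x)),
    ofReal_integral_eq_lintegral_ofReal]
  · exact Integrable.fintype_prod hf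
  · exact Filter.Eventually.of_forall fun z => Finset.prod_nonneg fun i _ => (Real.exp_pos _).le

theorem lintegral_pi_gaussian_exp_linear (v : ι → ℝ) :
    ∫⁻ z, ENNReal.ofReal (Real.exp (∑ i, v i * z i)) ∂Measure.pi (fun _ : ι => gaussianReal 0 1) =
      ENNReal.ofReal (Real.exp (∑ i, v i ^ 2 / 2)) := by
  rw [lintegral_pi_exp_sum _ (fun i x => v i * x) fun i => integrable_exp_mul_gaussianReal (v i)]
  congr 1
  rw [Real.exp_sum]
  refine Finset.prod_congr rfl fun i _ => ?_
  have h := congrFun (mgf_id_gaussianReal (μ := 0) (v := 1)) (v i)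
  simpa [mgf] using h

theorem gaussianPDFReal_mul_exp_sq (x : ℝ) :
    gaussianPDFReal 0 1 x * Real.exp (x ^ 2 / 4) =
      (√(2 * Real.pi))⁻¹ * Real.exp (-(1 / 4) * x ^ 2) := by
  simp only [gaussianPDFReal, NNReal.coe_one, mul_one, sub_zero]
  rw [mul_assoc, ← Real.exp_add]
  congr 2
  ring

theorem integrable_exp_sq_gaussian :
    Integrable (fun x => Real.exp (x ^ 2 / 4)) (gaussianReal 0 1) := by
  rw [gaussianReal_of_var_ne_zero 0 one_ne_zero,
    integrable_withDensity_iff (measurable_gaussianPDF 0 1)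
      (Filter.Eventually.of_forall fun _ => gaussianPDF_lt_top)]
  have h := (integrable_exp_neg_mul_sq (b := 1 / 4) (by norm_num)).const_mul (√(2 * Real.pi))⁻¹
  refine h.congr (Filter.Eventually.of_forall fun x => ?_)
  simp only [toReal_gaussianPDF]
  rw [← gaussianPDFReal_mul_exp_sq, mul_comm]

theorem integral_exp_sq_gaussian :
    ∫ x, Real.exp (x ^ 2 / 4) ∂gaussianReal 0 1 = √2 := by
  rw [integral_gaussianReal_eq_integral_smul one_ne_zero]
  simp_rw [smul_eq_mul, gaussianPDFReal_mul_exp_sq]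
  rw [integral_const_mul, integral_gaussian, ← Real.sqrt_inv, ← Real.sqrt_mul (by positivity)]
  congr 1
  have := Real.pi_pos
  field_simp
  norm_num

theorem lintegral_pi_gaussian_exp_sq :
    ∫⁻ z, ENNReal.ofReal (Real.exp (∑ i, z i ^ 2 / 4))
      ∂Measure.pi (fun _ : ι => gaussianReal 0 1) = ENNReal.ofReal (√2 ^ Fintype.card ι) := by
  rw [lintegral_pi_exp_sum _ (fun _ x => x ^ 2 / 4) fun _ => integrable_exp_sq_gaussian]
  simp [integral_exp_sq_gaussian]

/-- Exponential moment of `‖A z‖²` for a standard Gaussian vector `z`. -/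
theorem lintegral_exp_sq_mulVec_le (A : Matrix κ ι ℝ) {B : ℝ} (hB : 0 < B)
    (hA : ∀ h : κ → ℝ, ∑ i, (Aᵀ *ᵥ h) i ^ 2 ≤ B * ∑ j, h j ^ 2) :
    ∫⁻ z, ENNReal.ofReal (Real.exp ((∑ j, (A *ᵥ z) j ^ 2) / (4 * B)))
      ∂Measure.pi (fun _ : ι => gaussianReal 0 1) ≤ ENNReal.ofReal (√2 ^ Fintype.card κ) := by
  -- Linearise the square with an independent Gaussian `h`: `exp(c²‖Az‖²/2)` is the mean of
  -- `exp(c⟨Az, h⟩)`, and `c²/2 = 1/(4B)`. Integrating over `z` first gives `exp(c²‖Aᵀh‖²/2) ≤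
  -- exp(‖h‖²/4)`, whose mean is `√2` per coordinate.
  obtain ⟨c, hc⟩ : ∃ c : ℝ, c ^ 2 * B = 1 / 2 := by
    refine ⟨√(1 / (2 * B)), ?_⟩
    rw [Real.sq_sqrt (by positivity)]
    field_simp
  have hc2 : c ^ 2 = 1 / (2 * B) := by field_simp; linarith
  have h1 : ∀ z : ι → ℝ, ENNReal.ofReal (Real.exp ((∑ j, (A *ᵥ z) j ^ 2) / (4 * B))) =
      ∫⁻ h, ENNReal.ofReal (Real.exp (∑ j, (c * (A *ᵥ z) j) * h j))
        ∂Measure.pi (fun _ : κ => gaussianReal 0 1) := by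
    intro z
    rw [lintegral_pi_gaussian_exp_linear]
    congr 2
    rw [Finset.sum_div]
    refine Finset.sum_congr rfl fun j _ => ?_
    rw [mul_pow, hc2]
    field_simp
    norm_num
  have h2 : ∀ (z : ι → ℝ) (h : κ → ℝ), ∑ j, (c * (A *ᵥ z) j) * h j =
      ∑ i, (c * (Aᵀ *ᵥ h) i) * z i := by
    intro z h
    simp only [Matrix.mulVec, dotProduct, Matrix.transpose_apply, Finset.mul_sum, Finset.sum_mul]
    rw [Finset.sum_comm]
    refine Finset.sum_congr rfl fun i _ => Finset.sum_congr rfl fun j _ => by ring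
  simp_rw [h1, h2]
  rw [lintegral_lintegral_swap]
  · simp_rw [lintegral_pi_gaussian_exp_linear]
    rw [← lintegral_pi_gaussian_exp_sq]
    refine lintegral_mono fun h => ENNReal.ofReal_le_ofReal (Real.exp_le_exp.2 ?_)
    rw [← Finset.sum_div, ← Finset.sum_div]
    simp_rw [mul_pow]
    rw [← Finset.mul_sum]
    have := mul_le_mul_of_nonneg_left (hA h) (sq_nonneg c)
    have e : c ^ 2 * (B * ∑ j, h j ^ 2) = 1 / 2 * ∑ j, h j ^ 2 := by rw [← hc]; ring
    linarith
  · refine Measurable.aemeasurable ?_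
    refine ENNReal.measurable_ofReal.comp (Real.measurable_exp.comp ?_)
    simp only [Matrix.mulVec, dotProduct, Matrix.transpose_apply]
    fun_prop

theorem gaussian_sq_mulVec_tail (A : Matrix κ ι ℝ) {B : ℝ} (hB : 0 < B)
    (hA : ∀ h : κ → ℝ, ∑ i, (Aᵀ *ᵥ h) i ^ 2 ≤ B * ∑ j, h j ^ 2) (x : ℝ) :
    (Measure.pi (fun _ : ι => gaussianReal 0 1)).real {z | x ≤ ∑ j, (A *ᵥ z) j ^ 2} ≤
      √2 ^ Fintype.card κ * Real.exp (-(x / (4 * B))) := by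
  have hm : Measurable fun z : ι → ℝ =>
      ENNReal.ofReal (Real.exp ((∑ j, (A *ᵥ z) j ^ 2) / (4 * B))) := by
    refine ENNReal.measurable_ofReal.comp (Real.measurable_exp.comp ?_)
    simp only [Matrix.mulVec, dotProduct]
    fun_prop
  have h1 := (mul_meas_ge_le_lintegral (μ := Measure.pi (fun _ : ι => gaussianReal 0 1)) hm
    (ENNReal.ofReal (Real.exp (x / (4 * B))))).trans (lintegral_exp_sq_mulVec_le A hB hA)
  have hs : {z : ι → ℝ | ENNReal.ofReal (Real.exp (x / (4 * B))) ≤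
      ENNReal.ofReal (Real.exp ((∑ j, (A *ᵥ z) j ^ 2) / (4 * B)))} =
      {z | x ≤ ∑ j, (A *ᵥ z) j ^ 2} := by
    ext z
    simp only [Set.mem_ofPred_eq]
    rw [ENNReal.ofReal_le_ofReal_iff (Real.exp_pos _).le, Real.exp_le_exp,
      div_le_div_iff_of_pos_right (by positivity)]
  rw [hs, ← ofReal_measureReal, ← ENNReal.ofReal_mul (Real.exp_pos _).le,
    ENNReal.ofReal_le_ofReal_iff (by positivity)] at h1
  rw [Real.exp_neg, ← div_eq_mul_inv, le_div_iff₀ (Real.exp_pos _), mul_comm]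
  exact h1

end Gaussian

theorem noiseLaw_eq_map (n : ℕ) (σ : ℝ) :
    noiseLaw n σ = (Measure.pi fun _ : Fin n => gaussianReal 0 1).map fun z i => σ * z i := by
  rw [noiseLaw, Measure.pi_map_pi fun i => (measurable_const_mul σ).aemeasurable]
  congr 1
  funext i
  rw [gaussianReal_map_const_mul]
  congr 1
  · simp
  · ext
    simp [sq_nonneg]

/-! ### Restricted isometry and the Gram operator. -/

section RIP

variable {n p : ℕ}

theorem l2norm_sq {k : ℕ} (v : Fin k → ℝ) : l2norm v ^ 2 = ∑ i, v i ^ 2 := by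
  simp [l2norm, EuclideanSpace.norm_sq_eq]

theorem l2norm_nonneg {k : ℕ} (v : Fin k → ℝ) : 0 ≤ l2norm v := norm_nonneg _

theorem l2norm_sq_eq_dotProduct {k : ℕ} (v : Fin k → ℝ) : l2norm v ^ 2 = v ⬝ᵥ v := by
  rw [l2norm_sq]
  exact Finset.sum_congr rfl fun i _ => by ring

/-- The normalised Gram operator `n⁻¹ Xᵀ X`. -/
noncomputable def gram (X : Matrix (Fin n) (Fin p) ℝ) (z : Fin p → ℝ) : Fin p → ℝ :=
  (1 / n : ℝ) • (Xᵀ *ᵥ (X *ᵥ z))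

theorem gram_add (X : Matrix (Fin n) (Fin p) ℝ) (u v : Fin p → ℝ) :
    gram X (u + v) = gram X u + gram X v := by
  simp [gram, Matrix.mulVec_add]

theorem gram_sum_single (X : Matrix (Fin n) (Fin p) ℝ) (u : Fin p → ℝ) (j : Fin p) :
    gram X u j = ∑ k, u k * gram X (Pi.single k 1) j := by
  simp only [gram, Matrix.mulVec_mulVec, Matrix.mulVec_single_one, Pi.smul_apply, smul_eq_mul]
  rw [Matrix.mulVec, dotProduct, Finset.mul_sum]
  exact Finset.sum_congr rfl fun k _ => by
    rw [show (Xᵀ *ᵥ X.col k) j = (Xᵀ * X) j k from rfl]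
    ring

theorem residGrad_eq (X : Matrix (Fin n) (Fin p) ℝ) (b β : Fin p → ℝ) (w : Fin n → ℝ)
    (j : Fin p) :
    residGrad X (X *ᵥ b + w) β j =
      gram X (β - b) j - ((1 / n : ℝ) • (Xᵀ *ᵥ w)) j := by
  have : X *ᵥ β - (X *ᵥ b + w) = X *ᵥ (β - b) - w := by
    rw [Matrix.mulVec_sub]; abel
  rw [residGrad, this, Matrix.mulVec_sub, smul_sub]
  rfl

theorem dotProduct_gram (X : Matrix (Fin n) (Fin p) ℝ) (u v : Fin p → ℝ) :
    u ⬝ᵥ gram X v = (1 / n : ℝ) * ((X *ᵥ u) ⬝ᵥ (X *ᵥ v)) := by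
  rw [gram, dotProduct_smul, Matrix.dotProduct_mulVec, Matrix.vecMul_transpose, smul_eq_mul]

theorem supp_card_le {u : Fin p → ℝ} {T : Finset (Fin p)} (h : ∀ i ∉ T, u i = 0) :
    (supp u).card ≤ T.card := by
  refine Finset.card_le_card fun i hi => ?_
  by_contra hT
  simp [supp, h i hT] at hi

/-- The Gram operator is coordinatewise close to the identity on sparse vectors. -/
theorem RIP.abs_gram_sub_le {X : Matrix (Fin n) (Fin p) ℝ} {s : ℕ} {δ : ℝ} (h : RIP X (s + 1) δ)
    {u : Fin p → ℝ} {T : Finset (Fin p)} (hT : T.card ≤ s) (hu : ∀ i ∉ T, u i = 0) (j : Fin p) :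
    |gram X u j - u j| ≤ δ * l2norm u := by
  rcases (l2norm_nonneg u).eq_or_lt with h0 | h0
  · have hu0 : u = 0 := by
      have h1 := h0.symm
      rw [l2norm, norm_eq_zero] at h1
      simpa using h1
    subst hu0
    simp [gram, l2norm]
  set a := l2norm u with ha
  -- Polarisation between `u` and `a e_j`. Scaling `e_j` to the norm of `u` makes the bound sharp:
  -- the difference of the cases `ε = ±1` is `4a(gram X u - u)_j`, against `4δa²` on the right.
  have key : ∀ ε : ℝ, ε ^ 2 = 1 →
      |(1 / n : ℝ) * ((X *ᵥ (Pi.single j a + ε • u)) ⬝ᵥ (X *ᵥ (Pi.single j a + ε • u))) -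
        (Pi.single j a + ε • u) ⬝ᵥ (Pi.single j a + ε • u)| ≤
        δ * ((Pi.single j a + ε • u) ⬝ᵥ (Pi.single j a + ε • u)) := by
    intro ε _
    have hc : (supp (Pi.single j a + ε • u)).card ≤ s + 1 := by
      refine (supp_card_le (T := insert j T) fun i hi => ?_).trans
        ((Finset.card_insert_le _ _).trans (by omega))
      simp only [Finset.mem_insert, not_or] at hi
      simp [hi.1, hu i hi.2]
    have := h _ hc
    rw [l2norm_sq_eq_dotProduct, l2norm_sq_eq_dotProduct] at this
    rw [abs_le]
    constructor <;> linarith [this.1, this.2]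
  have huu : u ⬝ᵥ u = a ^ 2 := by rw [ha, l2norm_sq_eq_dotProduct]
  have h1 := abs_le.1 (key 1 (by norm_num))
  have h2 := abs_le.1 (key (-1) (by norm_num))
  have hg : (Pi.single j a : Fin p → ℝ) ⬝ᵥ gram X u = a * gram X u j := by simp
  rw [dotProduct_gram] at hg
  simp only [Matrix.mulVec_add, Matrix.mulVec_smul, add_dotProduct, dotProduct_add,
    smul_dotProduct, dotProduct_smul, smul_eq_mul, huu, dotProduct_comm u (Pi.single j a),
    dotProduct_comm (X *ᵥ u) (X *ᵥ Pi.single j a), single_dotProduct, Pi.single_eq_same] at h1 h2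
  have hb : |a * (gram X u j - u j)| ≤ a * (δ * a) := by
    rw [abs_le]
    constructor <;> nlinarith [h1.1, h1.2, h2.1, h2.2]
  rw [abs_mul, abs_of_pos h0] at hb
  exact le_of_mul_le_mul_left hb h0

/-- The iterate is not sparse, so its error is split. RIP applies directly to the part `u` on the
support; the dense part `v` is expanded into 1-sparse unit vectors, which costs its ℓ¹ norm,
affordable because its entries are of order `α²`. -/
theorem RIP.abs_gram_add_sub_le {X : Matrix (Fin n) (Fin p) ℝ} {s : ℕ} {δ : ℝ}
    (h : RIP X (s + 1) δ) (hs : 1 ≤ s) {u v : Fin p → ℝ} {T : Finset (Fin p)} (hT : T.card ≤ s)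
    (hu : ∀ i ∉ T, u i = 0) (j : Fin p) :
    |gram X (u + v) j - (u + v) j| ≤ δ * l2norm u + δ * ∑ k, |v k| := by
  have hv : |gram X v j - v j| ≤ δ * ∑ k, |v k| := by
    have e : v j = ∑ k, v k * (Pi.single k 1 : Fin p → ℝ) j := by
      simp [Pi.single_apply]
    rw [gram_sum_single X v j, e, ← Finset.sum_sub_distrib, Finset.mul_sum]
    refine (Finset.abs_sum_le_sum_abs _ _).trans (Finset.sum_le_sum fun k _ => ?_)
    rw [← mul_sub, abs_mul, mul_comm δ]
    refine mul_le_mul_of_nonneg_left ?_ (abs_nonneg _)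
    have := h.abs_gram_sub_le (u := Pi.single k 1) (T := {k}) (by simpa using hs)
      (fun i hi => by simp at hi; simp [hi]) j
    simpa [l2norm] using this
  have e : gram X (u + v) j - (u + v) j = (gram X u j - u j) + (gram X v j - v j) := by
    rw [gram_add]; simp only [Pi.add_apply]; ring
  rw [e]
  exact (abs_add_le _ _).trans (add_le_add (h.abs_gram_sub_le hT hu j) hv)

end RIP

/-! ### One gradient step in one coordinate. -/

section Scalar

variable {g l G η b : ℝ}

/-- The contraction coefficient of one coordinate of a gradient step. -/
noncomputable def stepRate (η g l G : ℝ) : ℝ := η * (g ^ 2 + l ^ 2 - η * G * (g * l))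

/-- When the rate lies in `[0, 1]`, the new error is a convex combination of the old error and minus
the deviation of `G` from the ideal gradient `gl - b`. Taking `b = 0` treats the coordinates that
are meant to stay small. -/
theorem step_error (g l G η b : ℝ) :
    (g - η * (l * G)) * (l - η * (g * G)) - b =
      (1 - stepRate η g l G) * (g * l - b) - stepRate η g l G * (G - (g * l - b)) := by
  rw [stepRate]; ring

/-- The imbalance `g² - l²` is nearly conserved and shrinks in absolute value when `|ηG| ≤ 1`, so it
never exceeds its initial value `α²`. The product `gl` therefore controls `g² + l²`. -/
theorem step_sq_sub_sq (g l G η : ℝ) :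
    (g - η * (l * G)) ^ 2 - (l - η * (g * G)) ^ 2 = (g ^ 2 - l ^ 2) * (1 - (η * G) ^ 2) := by
  ring

/-- The combinations `g ± l` diagonalise the update; this gives the geometric growth of a strong
coordinate for either sign of the signal. -/
theorem step_signed (g l G η : ℝ) {ς : ℝ} (hς : ς ^ 2 = 1) :
    (g - η * (l * G)) + ς * (l - η * (g * G)) = (g + ς * l) * (1 - η * (ς * G)) := by
  linear_combination (η * l * G) * hς

theorem two_mul_abs_le_sq_add_sq (g l : ℝ) : 2 * |g * l| ≤ g ^ 2 + l ^ 2 := by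
  rw [abs_mul, ← sq_abs g, ← sq_abs l]
  nlinarith [sq_nonneg (|g| - |l|)]

theorem sq_add_sq_le (g l : ℝ) : g ^ 2 + l ^ 2 ≤ 2 * |g * l| + |g ^ 2 - l ^ 2| := by
  have h : g ^ 2 - l ^ 2 = (|g| - |l|) * (|g| + |l|) := by
    rw [← sq_abs g, ← sq_abs l]; ring
  rw [h, abs_mul, abs_mul, abs_of_nonneg (by positivity : 0 ≤ |g| + |l|), ← sq_abs g, ← sq_abs l]
  have h1 : |(|g| - |l|)| ≤ |g| + |l| := by
    rw [abs_le]; constructor <;> linarith [abs_nonneg g, abs_nonneg l]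
  nlinarith [sq_abs (|g| - |l|), abs_nonneg (|g| - |l|), sq_nonneg (|g| - |l|)]

theorem le_stepRate (hη : 0 ≤ η) (hG : |η * G| ≤ 1) : η * |g * l| ≤ stepRate η g l G := by
  have h1 := two_mul_abs_le_sq_add_sq g l
  have h2 : η * G * (g * l) ≤ |g * l| := by
    refine (le_abs_self _).trans ?_
    rw [abs_mul]
    exact mul_le_of_le_one_left (abs_nonneg _) hG
  rw [stepRate]
  exact mul_le_mul_of_nonneg_left (by linarith) hη

theorem stepRate_le (hη : 0 ≤ η) (hG : |η * G| ≤ 1) :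
    stepRate η g l G ≤ η * (3 * |g * l| + |g ^ 2 - l ^ 2|) := by
  have h1 := sq_add_sq_le g l
  have h2 : -(η * G * (g * l)) ≤ |g * l| := by
    refine (neg_le_abs _).trans ?_
    rw [abs_mul]
    exact mul_le_of_le_one_left (abs_nonneg _) hG
  rw [stepRate]
  exact mul_le_mul_of_nonneg_left (by linarith) hη

theorem abs_step_error_le {B : ℝ} (h0 : 0 ≤ stepRate η g l G) (h1 : stepRate η g l G ≤ 1)
    (hB : |G - (g * l - b)| ≤ B) :
    |(g - η * (l * G)) * (l - η * (g * G)) - b| ≤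
      (1 - stepRate η g l G) * |g * l - b| + stepRate η g l G * B := by
  rw [step_error]
  refine (abs_sub _ _).trans ?_
  rw [abs_mul, abs_mul, abs_of_nonneg h0, abs_of_nonneg (sub_nonneg.2 h1)]
  gcongr

end Scalar

/-! ### The deterministic regime and its invariants. -/

variable {n p : ℕ}

theorem gd_fst_succ (X : Matrix (Fin n) (Fin p) ℝ) (y : Fin n → ℝ) (α η : ℝ) (t : ℕ) (j : Fin p) :
    (gd X y α η (t + 1)).1 j = (gd X y α η t).1 j -
      η * ((gd X y α η t).2 j * residGrad X y (betaIter X y α η t) j) := rfl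

theorem gd_snd_succ (X : Matrix (Fin n) (Fin p) ℝ) (y : Fin n → ℝ) (α η : ℝ) (t : ℕ) (j : Fin p) :
    (gd X y α η (t + 1)).2 j = (gd X y α η t).2 j -
      η * ((gd X y α η t).1 j * residGrad X y (betaIter X y α η t) j) := rfl

theorem betaIter_apply (X : Matrix (Fin n) (Fin p) ℝ) (y : Fin n → ℝ) (α η : ℝ) (t : ℕ)
    (j : Fin p) : betaIter X y α η t j = (gd X y α η t).1 j * (gd X y α η t).2 j := rfl

/-- The effective noise `n⁻¹ Xᵀ w`. -/
noncomputable def effNoise (X : Matrix (Fin n) (Fin p) ℝ) (w : Fin n → ℝ) : Fin p → ℝ :=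
  (1 / n : ℝ) • (Xᵀ *ᵥ w)

/-- The remaining convergence factor after `t` steps when contraction starts at time `T₁`. -/
noncomputable def decay (η m : ℝ) (T₁ t : ℕ) : ℝ := (1 - η * m / 4) ^ (t - T₁)

/-- The unavoidable error: noise on the strong coordinates, signal on the remaining ones. -/
noncomputable def floorVec (X : Matrix (Fin n) (Fin p) ℝ) (b : Fin p → ℝ) (w : Fin n → ℝ)
    (S : Finset (Fin p)) (j : Fin p) : ℝ :=
  if j ∈ S then |effNoise X w j| else |b j|

/-- Deterministic conditions under which gradient descent fits the coordinates in `S`, and only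
those, up to time `T`. -/
structure Regime (X : Matrix (Fin n) (Fin p) ℝ) (b : Fin p → ℝ) (w : Fin n → ℝ)
    (S : Finset (Fin p)) (s : ℕ) (δ α η m R N h c F : ℝ) (T₁ T : ℕ) : Prop where
  rip : RIP X (s + 1) δ
  one_le_s : 1 ≤ s
  card_supp : (supp b).card ≤ s
  δ_nonneg : 0 ≤ δ
  α_pos : 0 < α
  α_le : α ≤ 1
  η_pos : 0 < η
  m_pos : 0 < m
  m_le : ∀ j ∈ S, m ≤ |b j|
  le_R : ∀ j, |b j| ≤ R
  m_le_R : m ≤ R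
  weak_le : ∀ j ∉ S, |b j| ≤ c
  c_nonneg : 0 ≤ c
  c_le : c ≤ m
  noise_le : ∀ j, |effNoise X w j| ≤ h
  h_nonneg : 0 ≤ h
  floor_le : l2norm (floorVec X b w S) ≤ N
  -- Leakage between coordinates: the floor error in ℓ², and at most `p` remaining entries of size
  -- at most `α²/2` in ℓ¹.
  F_eq : F = δ * N + δ * (p * (α ^ 2 / 2))
  gap : h + 2 * F + δ * √s * R ≤ m / 4
  small : δ * √s ≤ 1 / 2
  step : η * (4 * R + 1) ≤ 1 / 4
  hit : 2 * R ≤ α ^ 2 * ((1 + η * m / 4) ^ (2 * T₁) - 1)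
  -- Early stopping: the total drive up to time `T` cannot carry a coordinate outside `S` beyond
  -- `α²/2`.
  growth : 3 * η * ∑ r ∈ Finset.range T, (c + h + 2 * F + δ * √s * R * decay η m T₁ r) ≤ 1 / 2

/-- The state of the iteration at time `t`. -/
structure Inv (X : Matrix (Fin n) (Fin p) ℝ) (b : Fin p → ℝ) (w : Fin n → ℝ)
    (S : Finset (Fin p)) (s : ℕ) (δ α η m R h c F : ℝ) (T₁ t : ℕ) : Prop where
  strong : ∀ j ∈ S, |betaIter X (X *ᵥ b + w) α η t j - b j| ≤
    |effNoise X w j| + 2 * F + R * decay η m T₁ t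
  off : ∀ j ∉ S, |betaIter X (X *ᵥ b + w) α η t j| ≤ α ^ 2 *
    (3 * η * ∑ r ∈ Finset.range t, (c + h + 2 * F + δ * √s * R * decay η m T₁ r))
  prod : ∀ j, |(gd X (X *ᵥ b + w) α η t).1 j ^ 2 - (gd X (X *ᵥ b + w) α η t).2 j ^ 2| ≤ α ^ 2
  grow : ∀ j ∈ S, ∀ ς : ℝ, ς ^ 2 = 1 → ς * b j = |b j| →
    |b j| / 2 ≤ ς * betaIter X (X *ᵥ b + w) α η t j ∨
      α * (1 + η * m / 4) ^ t ≤
        (gd X (X *ᵥ b + w) α η t).1 j + ς * (gd X (X *ᵥ b + w) α η t).2 j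

namespace Regime

variable {X : Matrix (Fin n) (Fin p) ℝ} {b : Fin p → ℝ} {w : Fin n → ℝ}
  {S : Finset (Fin p)} {s : ℕ} {δ α η m R N h c F : ℝ} {T₁ T t : ℕ}

theorem F_nonneg (H : Regime X b w S s δ α η m R N h c F T₁ T) : 0 ≤ F := by
  have hN := (l2norm_nonneg _).trans H.floor_le
  have hδ := H.δ_nonneg
  rw [H.F_eq]; positivity

theorem R_pos (H : Regime X b w S s δ α η m R N h c F T₁ T) : 0 < R := H.m_pos.trans_le H.m_le_R

theorem eta_m_le (H : Regime X b w S s δ α η m R N h c F T₁ T) : η * m ≤ 1 := by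
  nlinarith [H.step, H.η_pos, H.m_le_R, H.R_pos, mul_le_mul_of_nonneg_left H.m_le_R H.η_pos.le,
    mul_pos H.η_pos H.R_pos]

theorem decay_nonneg (H : Regime X b w S s δ α η m R N h c F T₁ T) (t : ℕ) :
    0 ≤ decay η m T₁ t := pow_nonneg (by linarith [H.eta_m_le]) _

theorem decay_le_one (H : Regime X b w S s δ α η m R N h c F T₁ T) (t : ℕ) :
    decay η m T₁ t ≤ 1 :=
  pow_le_one₀ (by linarith [H.eta_m_le]) (by linarith [mul_pos H.η_pos H.m_pos])

theorem coef_nonneg (H : Regime X b w S s δ α η m R N h c F T₁ T) : 0 ≤ δ * √s :=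
  mul_nonneg H.δ_nonneg (Real.sqrt_nonneg _)

theorem term_nonneg (H : Regime X b w S s δ α η m R N h c F T₁ T) (t : ℕ) :
    0 ≤ c + h + 2 * F + δ * √s * R * decay η m T₁ t := by
  have := mul_nonneg (mul_nonneg H.coef_nonneg H.R_pos.le) (H.decay_nonneg t)
  linarith [H.c_nonneg, H.h_nonneg, H.F_nonneg]

theorem off_half (H : Regime X b w S s δ α η m R N h c F T₁ T) (ht : t ≤ T)
    (I : Inv X b w S s δ α η m R h c F T₁ t) {j : Fin p} (hj : j ∉ S) :
    |betaIter X (X *ᵥ b + w) α η t j| ≤ α ^ 2 / 2 := by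
  refine (I.off j hj).trans ?_
  rw [div_eq_mul_one_div]
  refine mul_le_mul_of_nonneg_left (le_trans ?_ H.growth) (sq_nonneg _)
  refine mul_le_mul_of_nonneg_left ?_ (by linarith [H.η_pos])
  exact Finset.sum_le_sum_of_subset_of_nonneg (Finset.range_mono ht) fun i _ _ => H.term_nonneg i

theorem S_subset (H : Regime X b w S s δ α η m R N h c F T₁ T) : S ⊆ supp b := by
  intro j hj
  have := H.m_pos.trans_le (H.m_le j hj)
  simpa [supp] using this

/-- The sparse part of the error is dominated entrywise by `floorVec` plus the constant `2F + R
decay` on `S`, and `S` has at most `s` elements. -/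
theorem strong_le_l2 (H : Regime X b w S s δ α η m R N h c F T₁ T)
    (I : Inv X b w S s δ α η m R h c F T₁ t) :
    l2norm (fun j => if j ∈ S then betaIter X (X *ᵥ b + w) α η t j - b j else -b j) ≤
      N + √s * (2 * F + R * decay η m T₁ t) := by
  set a := 2 * F + R * decay η m T₁ t with ha
  have ha0 : 0 ≤ a := by
    have := mul_nonneg H.R_pos.le (H.decay_nonneg t)
    linarith [H.F_nonneg]
  have h1 : l2norm (fun j => if j ∈ S then betaIter X (X *ᵥ b + w) α η t j - b j else -b j) ≤
      l2norm (floorVec X b w S + fun j => if j ∈ S then a else 0) := by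
    refine (sq_le_sq₀ (l2norm_nonneg _) (l2norm_nonneg _)).1 ?_
    rw [l2norm_sq, l2norm_sq]
    refine Finset.sum_le_sum fun j _ => ?_
    by_cases hj : j ∈ S
    · simp only [hj, if_true, Pi.add_apply, floorVec]
      rw [← sq_abs]
      have := I.strong j hj
      gcongr
      linarith
    · simp [hj, floorVec]
  have h2 : l2norm (fun j => if j ∈ S then a else 0) ≤ √s * a := by
    refine (sq_le_sq₀ (l2norm_nonneg _) (by positivity)).1 ?_
    rw [l2norm_sq, mul_pow, Real.sq_sqrt (Nat.cast_nonneg _)]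
    simp only [ite_pow, ne_eq, OfNat.ofNat_ne_zero, not_false_eq_true, zero_pow]
    rw [Finset.sum_ite_mem, Finset.univ_inter, Finset.sum_const, nsmul_eq_mul]
    gcongr
    exact (Finset.card_le_card H.S_subset).trans H.card_supp
  have h3 : l2norm (floorVec X b w S + fun j => if j ∈ S then a else 0) ≤
      l2norm (floorVec X b w S) + l2norm (fun j => if j ∈ S then a else 0) := by
    simp only [l2norm, WithLp.toLp_add]
    exact norm_add_le _ _
  linarith [H.floor_le]

/-- The noise is kept as `|effNoise X w j|` instead of its uniform bound `h`, so that the final ℓ²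
error sees the noise energy on `S` without a factor `log p`. -/
theorem abs_residGrad_le (H : Regime X b w S s δ α η m R N h c F T₁ T) (ht : t ≤ T)
    (I : Inv X b w S s δ α η m R h c F T₁ t) (j : Fin p) :
    |residGrad X (X *ᵥ b + w) (betaIter X (X *ᵥ b + w) α η t) j -
      (betaIter X (X *ᵥ b + w) α η t j - b j)| ≤
      |effNoise X w j| + F + δ * √s * (2 * F + R * decay η m T₁ t) := by
  set β := betaIter X (X *ᵥ b + w) α η t with hβ
  have e : β - b = (fun j => if j ∈ S then β j - b j else -b j) +
      fun j => if j ∈ S then 0 else β j := by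
    funext k
    by_cases hk : k ∈ S <;> simp [hk]; ring
  have h1 := H.rip.abs_gram_add_sub_le H.one_le_s (u := fun j => if j ∈ S then β j - b j else -b j)
    (v := fun j => if j ∈ S then 0 else β j) H.card_supp (fun i hi => by
      have hiS : i ∉ S := fun hS => hi (H.S_subset hS)
      have : b i = 0 := by simpa [supp] using hi
      simp [hiS, this]) j
  rw [← e] at h1
  have h2 : ∑ k, |if k ∈ S then 0 else β k| ≤ p * (α ^ 2 / 2) := by
    refine (Finset.sum_le_card_nsmul Finset.univ _ (α ^ 2 / 2) fun k _ => ?_).trans (by simp)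
    by_cases hk : k ∈ S
    · simp only [hk, if_true, abs_zero]; positivity
    · simpa only [hk, if_false] using H.off_half ht I hk
  have h3 := H.strong_le_l2 I
  have h4 := mul_le_mul_of_nonneg_left h2 H.δ_nonneg
  have h5 := mul_le_mul_of_nonneg_left h3 H.δ_nonneg
  have e2 : residGrad X (X *ᵥ b + w) β j - (β j - b j) =
      (gram X (β - b) j - (β - b) j) - effNoise X w j := by
    rw [residGrad_eq]
    simp only [Pi.sub_apply, effNoise]
    ring
  rw [e2]
  refine (abs_sub _ _).trans ?_
  have hF := H.F_eq
  linarith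

theorem abs_residGrad_le' (H : Regime X b w S s δ α η m R N h c F T₁ T) (ht : t ≤ T)
    (I : Inv X b w S s δ α η m R h c F T₁ t) (j : Fin p) :
    |residGrad X (X *ᵥ b + w) (betaIter X (X *ᵥ b + w) α η t) j -
      (betaIter X (X *ᵥ b + w) α η t j - b j)| ≤
      h + 2 * F + δ * √s * R * decay η m T₁ t := by
  refine (H.abs_residGrad_le ht I j).trans ?_
  have := mul_le_mul_of_nonneg_right H.small H.F_nonneg
  linarith [H.noise_le j]

theorem term_le (H : Regime X b w S s δ α η m R N h c F T₁ T) (t : ℕ) :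
    h + 2 * F + δ * √s * R * decay η m T₁ t ≤ m / 4 := by
  have := mul_le_mul_of_nonneg_left (H.decay_le_one t) (mul_nonneg H.coef_nonneg H.R_pos.le)
  linarith [H.gap]

theorem abs_betaIter_sub_le (H : Regime X b w S s δ α η m R N h c F T₁ T) (ht : t ≤ T)
    (I : Inv X b w S s δ α η m R h c F T₁ t) (j : Fin p) :
    |betaIter X (X *ᵥ b + w) α η t j - b j| ≤ 3 / 2 * R + 1 / 2 := by
  by_cases hj : j ∈ S
  · have h1 := I.strong j hj
    have h2 := mul_le_mul_of_nonneg_left (H.decay_le_one t) H.R_pos.le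
    have h3 := mul_nonneg H.coef_nonneg H.R_pos.le
    linarith [H.noise_le j, H.gap, H.m_le_R, H.R_pos]
  · have h1 := H.off_half ht I hj
    have h2 := H.le_R j
    have h3 : α ^ 2 ≤ 1 := pow_le_one₀ H.α_pos.le H.α_le
    refine (abs_sub _ _).trans ?_
    linarith [H.R_pos]

theorem abs_eta_mul_le (H : Regime X b w S s δ α η m R N h c F T₁ T) (ht : t ≤ T)
    (I : Inv X b w S s δ α η m R h c F T₁ t) (j : Fin p) :
    |η * residGrad X (X *ᵥ b + w) (betaIter X (X *ᵥ b + w) α η t) j| ≤ 1 := by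
  have h1 := H.abs_residGrad_le' ht I j
  have h2 := H.abs_betaIter_sub_le ht I j
  have h3 := H.term_le t
  set G := residGrad X (X *ᵥ b + w) (betaIter X (X *ᵥ b + w) α η t) j
  set r := betaIter X (X *ᵥ b + w) α η t j - b j
  have h4 : |G| ≤ 4 * R + 1 := by
    have : |G| ≤ |G - r| + |r| := by simpa using abs_add_le (G - r) r
    linarith [H.m_le_R, H.R_pos]
  rw [abs_mul, abs_of_pos H.η_pos]
  have := mul_le_mul_of_nonneg_left h4 H.η_pos.le
  linarith [H.step]

theorem stepRate_le_one (H : Regime X b w S s δ α η m R N h c F T₁ T) (ht : t ≤ T)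
    (I : Inv X b w S s δ α η m R h c F T₁ t) (j : Fin p) :
    stepRate η ((gd X (X *ᵥ b + w) α η t).1 j) ((gd X (X *ᵥ b + w) α η t).2 j)
      (residGrad X (X *ᵥ b + w) (betaIter X (X *ᵥ b + w) α η t) j) ≤ 1 := by
  refine (stepRate_le H.η_pos.le (H.abs_eta_mul_le ht I j)).trans ?_
  rw [← betaIter_apply]
  have h1 := H.abs_betaIter_sub_le ht I j
  have h2 := I.prod j
  have h3 : α ^ 2 ≤ 1 := pow_le_one₀ H.α_pos.le H.α_le
  have h4 := H.le_R j
  have h5 : |betaIter X (X *ᵥ b + w) α η t j| ≤ 5 / 2 * R + 1 / 2 := by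
    have := abs_add_le (betaIter X (X *ᵥ b + w) α η t j - b j) (b j)
    rw [sub_add_cancel] at this
    linarith
  have h6 := mul_le_mul_of_nonneg_left (show 3 * |betaIter X (X *ᵥ b + w) α η t j| +
    |(gd X (X *ᵥ b + w) α η t).1 j ^ 2 - (gd X (X *ᵥ b + w) α η t).2 j ^ 2| ≤ 4 * (4 * R + 1) by
      linarith [H.R_pos]) H.η_pos.le
  linarith [H.step]

/-- On strong coordinates the signal has grown to half its size by time `T₁`. -/
theorem half_le (H : Regime X b w S s δ α η m R N h c F T₁ T)
    (I : Inv X b w S s δ α η m R h c F T₁ t) (hT : T₁ ≤ t) {j : Fin p} (hj : j ∈ S) :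
    |b j| / 2 ≤ |betaIter X (X *ᵥ b + w) α η t j| := by
  obtain ⟨ς, hς, hςb⟩ : ∃ ς : ℝ, ς ^ 2 = 1 ∧ ς * b j = |b j| := by
    rcases le_total 0 (b j) with h0 | h0
    · exact ⟨1, by norm_num, by rw [abs_of_nonneg h0, one_mul]⟩
    · exact ⟨-1, by norm_num, by rw [abs_of_nonpos h0]; ring⟩
  have hς1 : |ς| = 1 := by
    rw [← sq_eq_sq₀ (abs_nonneg _) zero_le_one, sq_abs, hς, one_pow]
  have hle : ς * betaIter X (X *ᵥ b + w) α η t j ≤ |betaIter X (X *ᵥ b + w) α η t j| := by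
    refine (le_abs_self _).trans ?_
    rw [abs_mul, hς1, one_mul]
  refine le_trans ?_ hle
  rcases I.grow j hj ς hς hςb with h1 | h1
  · exact h1
  have hpr := I.prod j
  rw [betaIter_apply]
  set g := (gd X (X *ᵥ b + w) α η t).1 j
  set l := (gd X (X *ᵥ b + w) α η t).2 j
  have hx : 0 ≤ η * m / 4 := by have := mul_pos H.η_pos H.m_pos; linarith
  have hα := H.α_pos
  set Q := (1 + η * m / 4) ^ t with hQ
  have hQ1 : 1 ≤ Q := one_le_pow₀ (by linarith)
  have hQ2 : (1 + η * m / 4) ^ (2 * T₁) ≤ Q ^ 2 := by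
    rw [hQ, ← pow_mul]
    exact pow_le_pow_right₀ (by linarith) (by omega)
  have hu : α ≤ g + ς * l := le_trans (by nlinarith) h1
  have hu2 : (α * Q) ^ 2 ≤ (g + ς * l) ^ 2 := pow_le_pow_left₀ (by positivity) h1 2
  have huv : |(g + ς * l) * (g - ς * l)| ≤ α ^ 2 := by
    have : (g + ς * l) * (g - ς * l) = g ^ 2 - l ^ 2 := by linear_combination -l ^ 2 * hς
    rw [this]; exact hpr
  have hv : |g - ς * l| ≤ α := by
    rw [abs_mul, abs_of_pos (hα.trans_le hu)] at huv
    -- With `u = g + ςl` and `v = g - ςl`, `|uv| ≤ α²` and `u ≥ α` force `|v| ≤ α`. Then `ςgl = (u²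
    -- - v²)/4` is at least `R/2` by `hit`.
    by_contra hcon
    push Not at hcon
    nlinarith
  have hv2 : (g - ς * l) ^ 2 ≤ α ^ 2 := by rw [← sq_abs]; gcongr
  have hR := H.le_R j
  have hhit := H.hit
  have e : ς * (g * l) = ((g + ς * l) ^ 2 - (g - ς * l) ^ 2) / 4 := by ring
  rw [e]
  have := mul_le_mul_of_nonneg_left hQ2 (sq_nonneg α)
  nlinarith

theorem inv_zero (H : Regime X b w S s δ α η m R N h c F T₁ T) :
    Inv X b w S s δ α η m R h c F T₁ 0 where
  strong j _ := by
    have := H.le_R j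
    simp [betaIter, gd, decay]
    linarith [abs_nonneg (effNoise X w j), H.F_nonneg]
  off j _ := by simp [betaIter, gd]
  prod j := by simp [gd]
  grow j _ ς _ _ := by simp [gd]

theorem inv_succ (H : Regime X b w S s δ α η m R N h c F T₁ T) (ht : t ≤ T)
    (I : Inv X b w S s δ α η m R h c F T₁ t) :
    Inv X b w S s δ α η m R h c F T₁ (t + 1) := by
  have hηm := H.eta_m_le
  have hd0 := H.decay_nonneg t
  have hR := H.R_pos
  have hF := H.F_nonneg
  have hη := H.η_pos
  refine ⟨fun j hj => ?_, fun j hj => ?_, fun j => ?_, fun j hj ς hς hςb => ?_⟩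
  · have hG := H.abs_eta_mul_le ht I j
    have h1 := H.stepRate_le_one ht I j
    have h0 := le_stepRate (g := (gd X (X *ᵥ b + w) α η t).1 j)
      (l := (gd X (X *ᵥ b + w) α η t).2 j) hη.le hG
    have hs := I.strong j hj
    have hB := H.abs_residGrad_le ht I j
    have hhalf := fun hT : T₁ ≤ t => H.half_le I hT hj
    rw [betaIter_apply X _ _ _ (t + 1), gd_fst_succ, gd_snd_succ]
    rw [betaIter_apply X _ _ _ t] at hs hB hhalf
    refine (abs_step_error_le (le_trans (by positivity) h0) h1 hB).trans ?_
    have hm := H.m_le j hj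
    have hy := abs_nonneg ((gd X (X *ᵥ b + w) α η t).1 j * (gd X (X *ᵥ b + w) α η t).2 j)
    generalize stepRate _ _ _ _ = ρ at *
    generalize |effNoise X w j| = x at *
    generalize |(gd X (X *ᵥ b + w) α η t).1 j * (gd X (X *ᵥ b + w) α η t).2 j| = y at *
    generalize |(gd X (X *ᵥ b + w) α η t).1 j * (gd X (X *ᵥ b + w) α η t).2 j - b j| = z at *
    have hρ : 0 ≤ ρ := le_trans (by positivity) h0
    set d := decay η m T₁ t with hd
    have hA : 0 ≤ 2 * F + R * d := by positivity
    have e1 := mul_le_mul_of_nonneg_left hs (sub_nonneg.2 h1)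
    have e2 := mul_le_mul_of_nonneg_left (mul_le_mul_of_nonneg_right H.small hA) hρ
    -- This is why the invariant carries `2F`: as `δ√s ≤ 1/2`, the leakage `F + δ√s·2F` is again at
    -- most `2F`, while the transient `R d` loses the factor `1 - ρ/2`.
    have e3 : (1 - ρ) * z + ρ * (x + F + δ * √s * (2 * F + R * d)) ≤
        x + 2 * F + R * (d * (1 - ρ / 2)) := by linarith
    refine e3.trans ?_
    have hRd := mul_nonneg hR.le hd0
    rcases lt_or_ge t T₁ with hT | hT
    -- Before `T₁` the truncated subtraction keeps `decay` equal to `1`, so no contraction is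
    -- required.
    · have hd1 : decay η m T₁ (t + 1) = d := by
        rw [hd, decay, decay, Nat.sub_eq_zero_of_le hT.le, Nat.sub_eq_zero_of_le (by omega)]
      rw [hd1]
      nlinarith
    · have hd1 : decay η m T₁ (t + 1) = d * (1 - η * m / 4) := by
        rw [hd, decay, decay, Nat.sub_add_comm hT, pow_succ]
      have := hhalf hT
      rw [hd1]
      -- After `T₁`, `ρ ≥ η|gl| ≥ η|b|/2 ≥ ηm/2`.
      have h3 : η * m / 4 ≤ ρ / 2 := by nlinarith
      have := mul_le_mul_of_nonneg_left h3 hRd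
      linarith
  · have hG := H.abs_eta_mul_le ht I j
    have h1 := H.stepRate_le_one ht I j
    have h0 := le_stepRate (g := (gd X (X *ᵥ b + w) α η t).1 j)
      (l := (gd X (X *ᵥ b + w) α η t).2 j) hη.le hG
    have h0' := le_trans (by positivity) h0
    have h2 := stepRate_le (g := (gd X (X *ᵥ b + w) α η t).1 j)
      (l := (gd X (X *ᵥ b + w) α η t).2 j) hη.le hG
    have hs := I.off j hj
    have hhalf := H.off_half ht I hj
    have hB := H.abs_residGrad_le' ht I j
    have hB' : |residGrad X (X *ᵥ b + w) (betaIter X (X *ᵥ b + w) α η t) j -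
        (betaIter X (X *ᵥ b + w) α η t j - 0)| ≤
        c + h + 2 * F + δ * √s * R * decay η m T₁ t := by
      have e : residGrad X (X *ᵥ b + w) (betaIter X (X *ᵥ b + w) α η t) j -
        (betaIter X (X *ᵥ b + w) α η t j - 0) =
          (residGrad X (X *ᵥ b + w) (betaIter X (X *ᵥ b + w) α η t) j -
        (betaIter X (X *ᵥ b + w) α η t j - b j)) - b j := by ring
      rw [e]
      refine (abs_sub _ _).trans ?_
      linarith [H.weak_le j hj]
    have hp := I.prod j
    rw [betaIter_apply X _ _ _ (t + 1), gd_fst_succ, gd_snd_succ, Finset.sum_range_succ]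
    rw [betaIter_apply X _ _ _ t] at hs hB' hhalf
    have h3 := abs_step_error_le h0' h1 hB'
    rw [sub_zero, sub_zero] at h3
    refine h3.trans ?_
    have hB0 := H.term_nonneg t
    set B := c + h + 2 * F + δ * √s * R * decay η m T₁ t
    -- The rate is at most `3ηα²`, since `|gl| ≤ α²/2` and `|g² - l²| ≤ α²`.
    have h4 := mul_le_mul_of_nonneg_left (show 3 * |(gd X (X *ᵥ b + w) α η t).1 j *
      (gd X (X *ᵥ b + w) α η t).2 j| + |(gd X (X *ᵥ b + w) α η t).1 j ^ 2 -
      (gd X (X *ᵥ b + w) α η t).2 j ^ 2| ≤ 3 * α ^ 2 by linarith [sq_nonneg α]) hη.le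
    have h5 := mul_le_mul_of_nonneg_right (h2.trans h4) hB0
    have h6 := mul_nonneg h0' (abs_nonneg ((gd X (X *ᵥ b + w) α η t).1 j *
      (gd X (X *ᵥ b + w) α η t).2 j))
    linarith
  · have hG := H.abs_eta_mul_le ht I j
    rw [gd_fst_succ, gd_snd_succ, step_sq_sub_sq, abs_mul]
    refine (mul_le_of_le_one_right (abs_nonneg _) ?_).trans (I.prod j)
    have := (sq_le_one_iff_abs_le_one _).2 hG
    rw [abs_le]
    constructor <;> nlinarith [sq_nonneg
      (η * residGrad X (X *ᵥ b + w) (betaIter X (X *ᵥ b + w) α η t) j)]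
  · have hG := H.abs_eta_mul_le ht I j
    have hm := H.m_le j hj
    have hmp := H.m_pos
    have hς1 : |ς| = 1 := by
      rw [← sq_eq_sq₀ (abs_nonneg _) zero_le_one, sq_abs, hς, one_pow]
    have hB := (H.abs_residGrad_le' ht I j).trans (H.term_le t)
    have hB1 : |ς * (residGrad X (X *ᵥ b + w) (betaIter X (X *ᵥ b + w) α η t) j -
        (betaIter X (X *ᵥ b + w) α η t j - b j))| ≤ m / 4 := by
      rw [abs_mul, hς1, one_mul]; exact hB
    have hB2 := abs_le.1 hB1
    have h1 := H.stepRate_le_one ht I j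
    have h0 := le_trans (by positivity) (le_stepRate (g := (gd X (X *ᵥ b + w) α η t).1 j)
      (l := (gd X (X *ᵥ b + w) α η t).2 j) hη.le hG)
    -- Past `|b|/2` the update averages `ςβ` with a value at least `3|b|/4`, so the coordinate stays
    -- there. Below it, `ςG ≤ m/4 - |b|/2 ≤ -m/4`, which yields the growth factor.
    by_cases hc : |b j| / 2 ≤ ς * betaIter X (X *ᵥ b + w) α η t j
    · left
      rw [betaIter_apply X _ _ _ (t + 1), gd_fst_succ, gd_snd_succ]
      have e := step_error ((gd X (X *ᵥ b + w) α η t).1 j) ((gd X (X *ᵥ b + w) α η t).2 j)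
        (residGrad X (X *ᵥ b + w) (betaIter X (X *ᵥ b + w) α η t) j) η (b j)
      rw [← betaIter_apply X _ _ _ t] at e
      generalize stepRate _ _ _ _ = ρ at *
      have e1 := mul_le_mul_of_nonneg_left hc (sub_nonneg.2 h1)
      have e2 := mul_le_mul_of_nonneg_left hB2.2 h0
      have e3 := mul_le_mul_of_nonneg_left hm h0
      have e4 := mul_nonneg h0 (abs_nonneg (b j))
      linear_combination e1 + e2 + e3 / 4 + e4 / 4 - ς * e - ρ * hςb
    · right
      push Not at hc
      have hu := (I.grow j hj ς hς hςb).resolve_left (not_le.2 hc)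
      have hx : 0 < η * m / 4 := by positivity
      rw [gd_fst_succ, gd_snd_succ, step_signed _ _ _ _ hς, pow_succ, ← mul_assoc]
      have hu0 : 0 ≤ α * (1 + η * m / 4) ^ t := by have := H.α_pos; positivity
      refine mul_le_mul hu ?_ (by linarith) (hu0.trans hu)
      have h5 : ς * residGrad X (X *ᵥ b + w) (betaIter X (X *ᵥ b + w) α η t) j ≤ -(m / 4) := by
        linarith
      have := mul_le_mul_of_nonneg_left h5 hη.le
      linarith

theorem inv (H : Regime X b w S s δ α η m R N h c F T₁ T) (ht : t ≤ T) :
    Inv X b w S s δ α η m R h c F T₁ t := by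
  induction t with
  | zero => exact H.inv_zero
  | succ t ih => exact H.inv_succ (by omega) (ih (by omega))

/-- The estimation error at time `T`. -/
theorem l2norm_sub_le (H : Regime X b w S s δ α η m R N h c F T₁ T) :
    l2norm (betaIter X (X *ᵥ b + w) α η T - b) ≤
      N + √s * (2 * F + R * decay η m T₁ T) + √p * (α ^ 2 / 2) := by
  have I := H.inv le_rfl
  set β := betaIter X (X *ᵥ b + w) α η T with hβ
  have e : β - b = (fun j => if j ∈ S then β j - b j else -b j) +
      fun j => if j ∈ S then 0 else β j := by
    funext k
    by_cases hk : k ∈ S <;> simp [hk]; ring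
  have h2 : l2norm (fun j => if j ∈ S then 0 else β j) ≤ √p * (α ^ 2 / 2) := by
    refine (sq_le_sq₀ (l2norm_nonneg _) (by positivity)).1 ?_
    rw [l2norm_sq, mul_pow, Real.sq_sqrt (Nat.cast_nonneg _)]
    refine (Finset.sum_le_card_nsmul Finset.univ _ ((α ^ 2 / 2) ^ 2) fun k _ => ?_).trans (by simp)
    by_cases hk : k ∈ S
    · simp only [hk, if_true, zero_pow two_ne_zero]; positivity
    · simp only [hk, if_false]
      rw [← sq_abs]
      have := H.off_half le_rfl I hk
      gcongr
  have h3 : l2norm (β - b) ≤ l2norm (fun j => if j ∈ S then β j - b j else -b j) +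
      l2norm (fun j => if j ∈ S then 0 else β j) := by
    rw [e]
    simp only [l2norm, WithLp.toLp_add]
    exact norm_add_le _ _
  linarith [H.strong_le_l2 I]

end Regime

/-! ### Concentration of the effective noise. -/

theorem effNoise_apply (X : Matrix (Fin n) (Fin p) ℝ) (w : Fin n → ℝ) (j : Fin p) :
    effNoise X w j = ∑ i, X i j / n * w i := by
  simp only [effNoise, Matrix.mulVec, dotProduct, Pi.smul_apply, smul_eq_mul,
    Matrix.transpose_apply, Finset.mul_sum]
  exact Finset.sum_congr rfl fun i _ => by ring

theorem effNoise_const_mul (X : Matrix (Fin n) (Fin p) ℝ) (σ : ℝ) (z : Fin n → ℝ) (j : Fin p) :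
    effNoise X (fun i => σ * z i) j = σ * effNoise X z j := by
  rw [effNoise_apply, effNoise_apply, Finset.mul_sum]
  exact Finset.sum_congr rfl fun i _ => by ring

theorem measurable_effNoise (X : Matrix (Fin n) (Fin p) ℝ) (j : Fin p) :
    Measurable fun w => effNoise X w j := by
  simp_rw [effNoise_apply]
  fun_prop

theorem RIP.effNoise_tail {X : Matrix (Fin n) (Fin p) ℝ} {k : ℕ} {δ : ℝ} (hX : RIP X k δ)
    (hδ : δ ≤ 1) (hn : 0 < n) {T : Finset (Fin p)} (hT : T.card ≤ k) (x : ℝ) :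
    (Measure.pi (fun _ : Fin n => gaussianReal 0 1)).real {z | x ≤ ∑ j ∈ T, effNoise X z j ^ 2} ≤
      √2 ^ T.card * Real.exp (-(n * x / 8)) := by
  have hn' : (0 : ℝ) < n := Nat.cast_pos.2 hn
  set A : Matrix T (Fin n) ℝ := fun j i => X i j / n with hA
  -- Extending `h` by zero to a sparse `u` gives `Aᵀh = n⁻¹Xu`, and RIP with `δ ≤ 1` bounds its
  -- squared norm by `(2/n)‖u‖²`.
  have h1 := gaussian_sq_mulVec_tail A (B := 2 / n) (by positivity) (fun h => ?_) x
  · have e1 : ∀ z, ∑ j, (A *ᵥ z) j ^ 2 = ∑ j ∈ T, effNoise X z j ^ 2 := by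
      intro z
      rw [← Finset.sum_coe_sort T]
      refine Finset.sum_congr rfl fun j _ => ?_
      rw [effNoise_apply]
      rfl
    have e2 : x / (4 * (2 / n)) = n * x / 8 := by field_simp; ring
    simpa only [e1, e2, Fintype.card_coe] using h1
  · set u : Fin p → ℝ := fun j => if hj : j ∈ T then h ⟨j, hj⟩ else 0 with hu
    have hc := (hX u ((supp_card_le (T := T) fun i hi => by simp [hu, hi]).trans hT)).2
    have e1 : ∀ i, (Aᵀ *ᵥ h) i = (1 / n : ℝ) * (X *ᵥ u) i := by
      intro i
      simp only [Matrix.mulVec, dotProduct, Matrix.transpose_apply, Finset.mul_sum]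
      rw [← Finset.sum_subset (Finset.subset_univ T) (fun j _ hj => by simp [hu, hj]),
        ← Finset.sum_coe_sort T]
      refine Finset.sum_congr rfl fun j _ => ?_
      simp only [hu, hA, j.2, dif_pos]
      ring
    have e2 : ∑ j, h j ^ 2 = l2norm u ^ 2 := by
      rw [l2norm_sq, ← Finset.sum_subset (Finset.subset_univ T) (fun j _ hj => by simp [hu, hj]),
        ← Finset.sum_coe_sort T]
      refine Finset.sum_congr rfl fun j _ => ?_
      simp only [hu, j.2, dif_pos]
    simp_rw [e1, mul_pow]
    rw [← Finset.mul_sum, ← l2norm_sq, e2]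
    have h2 : (1 / n : ℝ) * l2norm (X *ᵥ u) ^ 2 ≤ 2 * l2norm u ^ 2 :=
      hc.trans (mul_le_mul_of_nonneg_right (by linarith) (sq_nonneg _))
    have h3 := mul_le_mul_of_nonneg_left h2 (by positivity : (0 : ℝ) ≤ 1 / n)
    calc (1 / n : ℝ) ^ 2 * l2norm (X *ᵥ u) ^ 2 = 1 / n * (1 / n * l2norm (X *ᵥ u) ^ 2) := by ring
      _ ≤ _ := h3
      _ = _ := by ring

/-- With high probability the standardised effective noise is uniformly small, and small in
Euclidean norm on `S`. -/
theorem RIP.effNoise_good {X : Matrix (Fin n) (Fin p) ℝ} {k s₂ : ℕ} {δ M : ℝ} (hX : RIP X k δ)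
    (hδ : δ ≤ 1) (hn : 0 < n) (hp : 2 ≤ p) {S : Finset (Fin p)} (hS : S.card ≤ k)
    (hS1 : 1 ≤ S.card) (hM : 1 ≤ M) :
    1 - (p : ℝ)⁻¹ - Real.exp (-(M * (S.card + s₂ : ℕ))) ≤
      (Measure.pi (fun _ : Fin n => gaussianReal 0 1)).real
        {z | (∀ j, effNoise X z j ^ 2 < 64 * (Real.log p / n)) ∧
          ∑ j ∈ S, effNoise X z j ^ 2 < 16 * ((M * S.card + s₂ * Real.log p) / n)} := by
  have hn' : (0 : ℝ) < n := Nat.cast_pos.2 hn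
  have hp' : (2 : ℝ) ≤ p := by exact_mod_cast hp
  have hp0 : (0 : ℝ) < p := by linarith
  set γ := Measure.pi (fun _ : Fin n => gaussianReal 0 1)
  set L := Real.log p with hL
  have hL0 : 0 < L := Real.log_pos (by linarith)
  have hexpL : Real.exp L = p := Real.exp_log hp0
  set good := {z : Fin n → ℝ | (∀ j, effNoise X z j ^ 2 < 64 * (L / n)) ∧
          ∑ j ∈ S, effNoise X z j ^ 2 < 16 * ((M * S.card + s₂ * L) / n)} with hgood
  have hmeas : MeasurableSet good := by
    have h1 : MeasurableSet {z : Fin n → ℝ | ∀ j, effNoise X z j ^ 2 < 64 * (L / n)} := by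
      have : {z : Fin n → ℝ | ∀ j, effNoise X z j ^ 2 < 64 * (L / n)} =
          ⋂ j, {z | effNoise X z j ^ 2 < 64 * (L / n)} := by ext; simp
      rw [this]
      exact MeasurableSet.iInter fun j =>
        measurableSet_lt ((measurable_effNoise X j).pow_const 2) measurable_const
    exact h1.inter (measurableSet_lt
      (Finset.measurable_fun_sum _ fun j _ => (measurable_effNoise X j).pow_const 2)
      measurable_const)
  have hsub : goodᶜ ⊆ (⋃ j ∈ (Finset.univ : Finset (Fin p)),
      {z | 64 * (L / n) ≤ ∑ i ∈ {j}, effNoise X z i ^ 2}) ∪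
      {z | 16 * ((M * S.card + s₂ * L) / n) ≤ ∑ j ∈ S, effNoise X z j ^ 2} := by
    intro z hz
    by_contra hcon
    simp only [Set.mem_union, Set.mem_iUnion, Set.mem_ofPred_eq, Finset.sum_singleton, not_or,
      not_exists, not_le, Finset.mem_univ, true_implies] at hcon
    exact hz ⟨fun j => hcon.1 j, hcon.2⟩
  have hcoord : ∀ j : Fin p,
      γ.real {z | 64 * (L / n) ≤ ∑ i ∈ {j}, effNoise X z i ^ 2} ≤ 2 * ((p : ℝ)⁻¹) ^ 8 := by
    intro j
    refine (hX.effNoise_tail hδ hn (by simpa using hS1.trans hS) _).trans ?_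
    have e : -(n * (64 * (L / n)) / 8) = -L * (8 : ℕ) := by push_cast; field_simp; norm_num
    rw [Finset.card_singleton, pow_one, e, mul_comm (-L), Real.exp_nat_mul, Real.exp_neg, hexpL]
    have : √2 ≤ 2 := Real.sqrt_le_iff.2 ⟨by norm_num, by norm_num⟩
    gcongr
  have hinv : (p : ℝ)⁻¹ ≤ 1 / 2 := by
    rw [inv_eq_one_div]; exact one_div_le_one_div_of_le (by norm_num) hp'
  have hinv0 : 0 < (p : ℝ)⁻¹ := inv_pos.2 hp0
  have hU : γ.real (⋃ j ∈ (Finset.univ : Finset (Fin p)),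
      {z | 64 * (L / n) ≤ ∑ i ∈ {j}, effNoise X z i ^ 2}) ≤ (p : ℝ)⁻¹ / 2 := by
    refine (measureReal_biUnion_finset_le _ _).trans ?_
    refine (Finset.sum_le_card_nsmul _ _ _ fun j _ => hcoord j).trans ?_
    have e : (Finset.univ : Finset (Fin p)).card • (2 * ((p : ℝ)⁻¹) ^ 8) =
        2 * ((p : ℝ)⁻¹) ^ 6 * (p : ℝ)⁻¹ := by
      rw [Finset.card_univ, Fintype.card_fin, nsmul_eq_mul]; field_simp
    rw [e]
    have : ((p : ℝ)⁻¹) ^ 6 ≤ (1 / 2) ^ 6 := pow_le_pow_left₀ hinv0.le hinv 6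
    nlinarith
  have hexp1 : (2 : ℝ) ≤ Real.exp 1 := by linarith [Real.add_one_le_exp (1 : ℝ)]
  have hS' : (1 : ℝ) ≤ S.card := by exact_mod_cast hS1
  have hV : γ.real {z | 16 * ((M * S.card + s₂ * L) / n) ≤ ∑ j ∈ S, effNoise X z j ^ 2} ≤
      Real.exp (-(M * S.card) - 2 * (s₂ * L)) := by
    refine (hX.effNoise_tail hδ hn hS _).trans ?_
    have h2 : √2 ^ S.card ≤ Real.exp S.card := by
      have : √2 ≤ Real.exp 1 :=
        (Real.sqrt_le_iff.2 ⟨by norm_num, by norm_num⟩ : √2 ≤ 2).trans hexp1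
      calc √2 ^ S.card ≤ Real.exp 1 ^ S.card := by gcongr
        _ = Real.exp S.card := by rw [← Real.exp_nat_mul, mul_one]
    refine (mul_le_mul_of_nonneg_right h2 (Real.exp_pos _).le).trans ?_
    rw [← Real.exp_add, Real.exp_le_exp]
    have e : n * (16 * ((M * S.card + s₂ * L) / n)) / 8 = 2 * (M * S.card + s₂ * L) := by
      field_simp; norm_num
    rw [e]
    nlinarith
  -- `M` may exceed `log p`, so `exp(-M(s₁ + s₂))` alone need not dominate. If `s₂ ≥ 1`, the left
  -- side is at most `1/(2p)`, the half of `1/p` left unused by the coordinatewise bound.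
  have hV2 : Real.exp (-(M * S.card) - 2 * (s₂ * L)) ≤
      (p : ℝ)⁻¹ / 2 + Real.exp (-(M * (S.card + s₂ : ℕ))) := by
    rcases Nat.eq_zero_or_pos s₂ with h0 | h0
    · subst h0
      simp only [CharP.cast_eq_zero, zero_mul, mul_zero, sub_zero, add_zero]
      linarith
    · have h1 : (1 : ℝ) ≤ s₂ := by exact_mod_cast h0
      have h2 : Real.exp (-(M * S.card) - 2 * (s₂ * L)) ≤ Real.exp (-1 + -L) :=
        Real.exp_le_exp.2 (by nlinarith)
      rw [Real.exp_add, Real.exp_neg L, hexpL] at h2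
      have h3 : Real.exp (-1) ≤ 1 / 2 := by
        rw [Real.exp_neg, inv_eq_one_div]
        exact one_div_le_one_div_of_le (by norm_num) hexp1
      have := Real.exp_pos (-(M * (S.card + s₂ : ℕ)))
      nlinarith
  have hfin : γ.real goodᶜ ≤ (p : ℝ)⁻¹ + Real.exp (-(M * (S.card + s₂ : ℕ))) := by
    refine (measureReal_mono hsub).trans ((measureReal_union_le _ _).trans ?_)
    linarith
  rw [probReal_compl_eq_one_sub hmeas] at hfin
  linarith

/-! ### Strong and weak signals. -/

theorem abs_le_theta_one (b : Fin p → ℝ) (j : Fin p) : |b j| ≤ theta 1 b := by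
  refine le_csSup ⟨∑ i, |b i|, fun x hx => ?_⟩ ?_
  · obtain ⟨i, hi⟩ := Finset.card_pos.1 (Nat.lt_of_lt_of_le zero_lt_one hx)
    exact (Finset.mem_filter.1 hi).2.trans
      (Finset.single_le_sum (f := fun i => |b i|) (fun _ _ => abs_nonneg _) (Finset.mem_univ i))
  · exact Finset.card_pos.2 ⟨j, by simp⟩

/-- The strong set is upward closed in `|b|`, so a level above its minimum is reached only by a
proper subset of it. The `s₁`-th largest value is therefore that minimum. -/
theorem minStrong_spec {σ : ℝ} {b : Fin p → ℝ} (hS : 1 ≤ (strong n σ b).card) :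
    0 < minStrong n σ b ∧ ∀ j ∈ strong n σ b, minStrong n σ b ≤ |b j| := by
  obtain ⟨i, hi, hmin⟩ := Finset.exists_min_image (strong n σ b) (fun j => |b j|)
    (Finset.card_pos.1 hS)
  have hi' := hi
  simp only [strong, supp, Finset.mem_filter, Finset.mem_univ, true_and] at hi'
  have hpos : 0 < |b i| := abs_pos.2 hi'.1
  have hg : IsGreatest {x : ℝ | (strong n σ b).card ≤
      (Finset.univ.filter fun i => x ≤ |b i|).card} |b i| := by
    refine ⟨Finset.card_le_card fun j hj => by simpa using hmin j hj, fun x hx => ?_⟩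
    by_contra! hlt
    refine absurd (show (strong n σ b).card ≤ _ from hx) (not_le.2 (Finset.card_lt_card ?_))
    refine (Finset.ssubset_iff_of_subset fun j hj => ?_).2 ⟨i, hi, by simpa using hlt⟩
    have hj' : x ≤ |b j| := by simpa using hj
    simp only [strong, supp, Finset.mem_filter, Finset.mem_univ, true_and]
    exact ⟨abs_pos.1 (by linarith), by linarith [hi'.2]⟩
  have e : minStrong n σ b = |b i| := hg.csSup_eq
  rw [e]
  exact ⟨hpos, hmin⟩

/-- If the support splits by cardinality into strong and weak signals, every coordinate that is not
strong is bounded by the weak threshold. -/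
theorem abs_le_of_notMem_strong {σ : ℝ} (hσ : 0 ≤ σ) {b : Fin p → ℝ}
    (hs : (supp b).card = (strong n σ b).card + (weak n σ b).card) {j : Fin p}
    (hj : j ∉ strong n σ b) : |b j| ≤ 2 * (σ * √(Real.log p / n)) := by
  have hτ : 0 ≤ σ * √(Real.log p / n) := by positivity
  by_cases hb : b j = 0
  · rw [hb, abs_zero]; positivity
  have hjs : j ∈ supp b := by simpa [supp] using hb
  -- For `log p ≤ 1` the strong threshold does not exceed the weak one. For `log p > 1` the two sets
  -- are disjoint, and the cardinality identity makes them cover the support.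
  rcases le_or_gt (Real.log p) 1 with hL | hL
  · have : ¬ 2 * σ * Real.log p * √(Real.log p / n) ≤ |b j| := fun h =>
      hj (Finset.mem_filter.2 ⟨hjs, h⟩)
    have := mul_le_mul_of_nonneg_right hL hτ
    linarith
  · have hdis : Disjoint (strong n σ b) (weak n σ b) := by
      rw [Finset.disjoint_left]
      intro i h1 h2
      have h1' := (Finset.mem_filter.1 h1).2
      have h2' := (Finset.mem_filter.1 h2).2
      have h3 : 0 < |b i| := abs_pos.2 (by simpa [supp] using (Finset.mem_filter.1 h1).1)
      have h4 : 0 < σ * √(Real.log p / n) := by linarith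
      nlinarith
    have hu : strong n σ b ∪ weak n σ b = supp b := by
      refine Finset.eq_of_subset_of_card_le
        (Finset.union_subset (Finset.filter_subset _ _) (Finset.filter_subset _ _)) ?_
      rw [Finset.card_union_of_disjoint hdis, hs]
    rw [← hu] at hjs
    have := (Finset.mem_filter.1 ((Finset.mem_union.1 hjs).resolve_left hj)).2
    linarith

/-! ### Estimates behind the choice of times and constants. -/

theorem sum_decay_le {η m : ℝ} (h0 : 0 < η * m) (h1 : η * m ≤ 1) (T₁ T : ℕ) :
    ∑ r ∈ Finset.range T, decay η m T₁ r ≤ T₁ + 4 / (η * m) := by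
  have hx0 : 0 ≤ 1 - η * m / 4 := by linarith
  have h2 : ∑ r ∈ Finset.range T, decay η m T₁ r ≤
      ∑ r ∈ Finset.range (T₁ + T), decay η m T₁ r :=
    Finset.sum_le_sum_of_subset_of_nonneg (Finset.range_mono (by omega))
      fun i _ _ => pow_nonneg hx0 _
  refine h2.trans ?_
  rw [Finset.sum_range_add]
  refine add_le_add ?_ ?_
  · refine (Finset.sum_le_card_nsmul _ _ 1 fun r hr => ?_).trans (by simp)
    exact pow_le_one₀ hx0 (by linarith)
  · simp only [decay, Nat.add_sub_cancel_left]
    have h3 := mul_neg_geom_sum (1 - η * m / 4) T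
    rw [le_div_iff₀ h0]
    have h4 := pow_nonneg hx0 T
    linarith

theorem exp_half_le_one_add {x : ℝ} (h0 : 0 ≤ x) (h1 : x ≤ 1) : Real.exp (x / 2) ≤ 1 + x := by
  rw [← Real.le_log_iff_exp_le (by linarith)]
  refine le_trans ?_ (Real.one_sub_inv_le_log_of_pos (by linarith))
  have : 1 - (1 + x)⁻¹ = x / (1 + x) := by field_simp; ring
  rw [this]
  exact div_le_div_of_nonneg_left h0 (by linarith) (by linarith)

theorem RIP.nonneg {X : Matrix (Fin n) (Fin p) ℝ} {k : ℕ} {δ : ℝ} (h : RIP X k δ) (hk : 1 ≤ k)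
    (j : Fin p) : 0 ≤ δ := by
  have h1 := h (Pi.single j 1) ((supp_card_le (T := {j}) fun i hi => by
    simp at hi; simp [hi]).trans (by simpa using hk))
  have h2 : l2norm (Pi.single j 1 : Fin p → ℝ) = 1 := by simp [l2norm]
  rw [h2] at h1
  linarith [h1.1, h1.2]

theorem l2norm_floorVec_sq (X : Matrix (Fin n) (Fin p) ℝ) (b : Fin p → ℝ) (w : Fin n → ℝ)
    (S : Finset (Fin p)) :
    l2norm (floorVec X b w S) ^ 2 =
      ∑ j ∈ S, effNoise X w j ^ 2 + ∑ j ∈ supp b \ S, b j ^ 2 := by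
  have h1 : ∀ j, floorVec X b w S j ^ 2 =
      (if j ∈ S then effNoise X w j ^ 2 else 0) + if j ∈ supp b \ S then b j ^ 2 else 0 := by
    intro j
    by_cases hj : j ∈ S
    · simp [floorVec, hj]
    · by_cases hb : b j = 0 <;> simp [floorVec, hj, hb, supp]
  rw [l2norm_sq]
  simp_rw [h1]
  rw [Finset.sum_add_distrib, Finset.sum_ite_mem, Finset.sum_ite_mem, Finset.univ_inter,
    Finset.univ_inter]

/-- Supplies `Regime.hit` with `x = ηm/4`: the power is at least `exp(T₁x) ≥ (p/α)⁴`, and `α²(p/α)⁴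
= p²(p/α)²` exceeds `2R + α²`. -/
theorem two_mul_le_of_exp_growth {p α K R x Λ : ℝ} {T₁ : ℕ} (hp1 : 1 ≤ p) (hα : 0 < α)
    (hα1 : α ≤ 1) (hK : 0 ≤ K) (hKm : R ≤ K) (hx0 : 0 ≤ x) (hx1 : x ≤ 1)
    (hpα : 256 * (1 + K) ≤ p / α) (hΛ : Real.exp Λ = p / α) (hT : 4 * Λ ≤ T₁ * x) :
    2 * R ≤ α ^ 2 * ((1 + x) ^ (2 * T₁) - 1) := by
  have h2 : (p / α) ^ 4 ≤ (1 + x) ^ (2 * T₁) := by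
    calc (p / α) ^ 4 = Real.exp ((4 : ℕ) * Λ) := by rw [Real.exp_nat_mul, hΛ]
      _ ≤ Real.exp ((2 * T₁ : ℕ) * (x / 2)) := Real.exp_le_exp.2 (by push_cast; linarith)
      _ = Real.exp (x / 2) ^ (2 * T₁) := by rw [Real.exp_nat_mul]
      _ ≤ _ := pow_le_pow_left₀ (Real.exp_pos _).le (exp_half_le_one_add hx0 hx1) _
  have h3 := mul_le_mul_of_nonneg_left h2 (sq_nonneg α)
  have h4 : α ^ 2 * (p / α) ^ 4 = p ^ 2 * (p / α) ^ 2 := by field_simp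
  have h6 : p / α ≤ (p / α) ^ 2 := le_self_pow₀ (by linarith) two_ne_zero
  have h7 : (p / α) ^ 2 ≤ p ^ 2 * (p / α) ^ 2 :=
    le_mul_of_one_le_left (sq_nonneg _) (one_le_pow₀ hp1)
  have h8 : α ^ 2 ≤ 1 := pow_le_one₀ hα.le hα1
  linarith

/-- Supplies `Regime.growth`. The constant drive contributes at most `3·12/144 = 1/4`, the transient
at most `3·21c₀ < 1/4`. -/
theorem sum_growth_le {η m γ R a τ c₀ Λ : ℝ} {T₁ T : ℕ} (hη : 0 < η) (hm : 0 < m)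
    (hηm : η * m ≤ 1) (hγR0 : 0 ≤ γ * R) (ha : a ≤ 12 * τ) (hT : T * (η * τ) ≤ 1 / 144)
    (hT₁ : T₁ * (η * m) ≤ 17 * Λ) (hγRΛ : γ * R * Λ ≤ c₀ * m) (hγR : γ * R ≤ c₀ * m)
    (hc : c₀ ≤ 1 / 256) :
    3 * η * ∑ r ∈ Finset.range T, (a + γ * R * decay η m T₁ r) ≤ 1 / 2 := by
  have h1 := sum_decay_le (mul_pos hη hm) hηm T₁ T
  rw [Finset.sum_add_distrib, ← Finset.mul_sum, Finset.sum_const, Finset.card_range,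
    nsmul_eq_mul]
  have h2 := mul_le_mul_of_nonneg_left h1 hγR0
  have h3 : (T : ℝ) * a ≤ T * (12 * τ) := mul_le_mul_of_nonneg_left ha (Nat.cast_nonneg _)
  have h4 := mul_le_mul_of_nonneg_left (add_le_add h3 h2) hη.le
  have h5 : η * (γ * R * (T₁ + 4 / (η * m))) ≤ 21 * c₀ := by
    refine le_of_mul_le_mul_right ?_ hm
    have e : η * (γ * R * (T₁ + 4 / (η * m))) * m =
        γ * R * (T₁ * (η * m)) + 4 * (γ * R) := by field_simp
    rw [e]
    have := mul_le_mul_of_nonneg_left hT₁ hγR0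
    linarith
  linarith

theorem sqrt_mul_decay_le {s p K R α d : ℝ} (hp1 : 1 ≤ p) (hsp : s ≤ p) (hα : 0 < α)
    (hα1 : α ≤ 1) (hKα : K * α ≤ 1) (hR : 0 ≤ R) (hKm : R ≤ K) (hd : 0 ≤ d)
    (hdecay : d ≤ (α / p) ^ 4) : √s * (R * d) ≤ α := by
  have hp0 : 0 < p := by linarith
  have hK : 0 ≤ K := hR.trans hKm
  have h1 : √s ≤ p := Real.sqrt_le_iff.2 ⟨hp0.le, hsp.trans (by nlinarith)⟩
  have h2 : R * d ≤ K * (α / p) ^ 4 := mul_le_mul hKm hdecay hd hK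
  have h3 : √s * (R * d) ≤ p * (K * (α / p) ^ 4) := mul_le_mul h1 h2 (mul_nonneg hR hd) hp0.le
  refine h3.trans ?_
  have e : p * (K * (α / p) ^ 4) = α * ((K * α) * (α / p) ^ 2 * (1 / p)) := by
    field_simp
  rw [e]
  refine mul_le_of_le_one_right hα.le ?_
  have h5 : α / p ≤ 1 := by rw [div_le_one hp0]; linarith
  have h6 : 1 / p ≤ 1 := by rw [div_le_one hp0]; exact hp1
  have h7 : 0 ≤ α / p := by positivity
  have h8 : 0 ≤ 1 / p := by positivity
  exact mul_le_one₀ (mul_le_one₀ hKα (pow_nonneg h7 2) (pow_le_one₀ h7 h5)) h8 h6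

theorem sqrt_mul_sq_half_le {p α : ℝ} (hp1 : 1 ≤ p) (hα : 0 < α) (hpα : p * α ≤ 1) :
    √p * (α ^ 2 / 2) ≤ α := by
  have h1 : √p ≤ p := Real.sqrt_le_iff.2 ⟨by linarith, by nlinarith⟩
  have h2 := mul_le_mul_of_nonneg_right h1 (by positivity : 0 ≤ α ^ 2 / 2)
  have h3 := mul_le_mul_of_nonneg_right hpα hα.le
  linarith

/-! ### From the hypotheses of the theorem to a `Regime`. -/

set_option maxHeartbeats 1000000 in
/-- The deterministic error bound on the event that the effective noise is controlled. -/
theorem error_le {K : ℝ} (hK : 0 < K) {X : Matrix (Fin n) (Fin p) ℝ} {b : Fin p → ℝ}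
    {w : Fin n → ℝ} {S : Finset (Fin p)} {s₂ T : ℕ} {δ α η m κ τ₀ τ : ℝ}
    (hS1 : 1 ≤ S.card) (hcard : (supp b).card = S.card + s₂)
    (hm : 0 < m) (hmS : ∀ j ∈ S, m ≤ |b j|) (hR : ∀ j, |b j| ≤ κ * m) (hKm : κ * m ≤ K)
    (hweak : ∀ j ∉ S, |b j| ≤ 2 * τ₀) (hτ₀ : 0 ≤ τ₀) (hτ₀τ : τ₀ ≤ τ) (hδτ : δ * α ≤ τ)
    (hnoise : ∀ j, effNoise X w j ^ 2 ≤ 64 * τ₀ ^ 2)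
    (hX : RIP X ((supp b).card + 1) δ)
    (hδ : δ ≤ 1 / (256 * (1 + K)) / (κ * √((supp b).card) * Real.log (p / α)))
    (hα : 0 < α) (hαp : α ≤ 1 / (256 * (1 + K)) / p)
    (hη : 0 < η) (hη' : η ≤ 1 / (256 * (1 + K)) / (κ * Real.log (p / α)))
    (hT1 : 33 * Real.log (p / α) / (η * m) ≤ T) (hT2 : T * (η * τ) ≤ 1 / 144) :
    l2norm (betaIter X (X *ᵥ b + w) α η T - b) ^ 2 ≤
      8 * (∑ j ∈ S, effNoise X w j ^ 2 + s₂ * (4 * τ₀ ^ 2)) + 18 * α ^ 2 := by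
  have hSsub : S ⊆ supp b := by
    intro j hj
    have := hm.trans_le (hmS j hj)
    simpa [supp] using this
  obtain ⟨j₀, hj₀⟩ := Finset.card_pos.1 hS1
  have hκ : 1 ≤ κ := by
    have := (hmS j₀ hj₀).trans (hR j₀)
    by_contra! h
    nlinarith
  have hp1 : (1 : ℝ) ≤ p := by
    have : 1 ≤ p := Nat.one_le_iff_ne_zero.2 (by rintro rfl; exact j₀.elim0)
    exact_mod_cast this
  set s := (supp b).card with hs
  have hs1 : 1 ≤ s := by omega
  have hsp : (s : ℝ) ≤ p := by
    have : s ≤ p := by simpa using Finset.card_le_univ (supp b)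
    exact_mod_cast this
  have hs1' : (1 : ℝ) ≤ s := by exact_mod_cast hs1
  have hδ0 : 0 ≤ δ := hX.nonneg (by omega) j₀
  set c₀ := 1 / (256 * (1 + K)) with hc₀
  have hc0 : 0 < c₀ := by positivity
  have hcK : c₀ * (1 + K) = 1 / 256 := by rw [hc₀]; field_simp
  clear_value c₀
  have hc1 : c₀ ≤ 1 / 256 := by nlinarith
  have hcKle : c₀ * K ≤ 1 / 256 := by nlinarith
  have hpα : p * α ≤ c₀ := by
    rw [le_div_iff₀ (by linarith)] at hαp; linarith
  have hαc : α ≤ c₀ := (le_mul_of_one_le_left hα.le hp1).trans hpα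
  have hpa : 256 ≤ p / α := by
    rw [le_div_iff₀ hα]; linarith
  set Λ := Real.log (p / α) with hΛ
  have hexpΛ : Real.exp Λ = p / α := Real.exp_log (by linarith)
  have hΛ1 : 1 ≤ Λ := by
    rw [hΛ, Real.le_log_iff_exp_le (by linarith)]
    linarith [Real.exp_one_lt_d9]
  clear_value Λ s
  set γ := δ * √s with hγ
  have hγ0 : 0 ≤ γ := by positivity
  set R := κ * m with hRdef
  have hmR : m ≤ R := le_mul_of_one_le_left hm.le hκ
  have hR0 : 0 < R := by linarith
  have hsq : 1 ≤ √(s : ℝ) := Real.one_le_sqrt.2 hs1'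
  have hγκ : γ * (κ * Λ) ≤ c₀ := by
    rw [le_div_iff₀ (by positivity)] at hδ
    rw [hγ]; linarith
  clear_value γ R
  have hκΛ : 1 ≤ κ * Λ := one_le_mul_of_one_le_of_one_le hκ hΛ1
  have hγc : γ ≤ c₀ := (le_mul_of_one_le_right hγ0 hκΛ).trans hγκ
  have hγRΛ : γ * R * Λ ≤ c₀ * m := by
    have := mul_le_mul_of_nonneg_right hγκ hm.le
    rw [hRdef]; linarith
  have hγR0 : 0 ≤ γ * R := by positivity
  have hγR : γ * R ≤ c₀ * m := (le_mul_of_one_le_right hγR0 hΛ1).trans hγRΛ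
  have hηκ : η * (κ * Λ) ≤ c₀ := by
    rwa [le_div_iff₀ (by positivity)] at hη'
  have hηc : η ≤ c₀ := (le_mul_of_one_le_right hη.le hκΛ).trans hηκ
  have hηR : η * R ≤ 1 / 256 := by
    have : η * R ≤ c₀ * K := mul_le_mul hηc hKm hR0.le hc0.le
    linarith
  have hηm0 : 0 < η * m := by positivity
  have hηm : η * m ≤ 1 / 256 := by
    have := mul_le_mul_of_nonneg_left hmR hη.le
    linarith
  have hTm : 33 * Λ ≤ T * (η * m) := by rwa [div_le_iff₀ hηm0] at hT1
  have hτ0 : 0 ≤ τ := hτ₀.trans hτ₀τ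
  -- A nonempty time window already separates `m` from the noise level: compare `33 ≤ Tηm` with `Tητ
  -- ≤ 1/144`.
  have hτm : 33 * τ ≤ 1 / 144 * m := by
    have h1 := mul_le_mul_of_nonneg_right hTm hτ0
    have h2 := mul_le_mul_of_nonneg_right hT2 hm.le
    have h3 := mul_le_mul_of_nonneg_right hΛ1 hτ0
    linarith
  -- Of the `33Λ/(ηm)` available steps, at most `17Λ/(ηm)` serve the growth phase; the remaining
  -- `16Λ/(ηm)` contract the error by `(α/p)⁴`.
  set T₁ := ⌈16 * Λ / (η * m)⌉₊ with hT₁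
  have hT₁l : 16 * Λ ≤ T₁ * (η * m) := by
    rw [← div_le_iff₀ hηm0]; exact Nat.le_ceil _
  have hT₁u : T₁ * (η * m) ≤ 17 * Λ := by
    have h1 := (Nat.ceil_lt_add_one (a := 16 * Λ / (η * m)) (by positivity)).le
    rw [← hT₁] at h1
    have h2 := mul_le_mul_of_nonneg_right h1 hηm0.le
    rw [add_mul, div_mul_cancel₀ _ hηm0.ne'] at h2
    linarith
  clear_value T₁
  set N := l2norm (floorVec X b w S) with hN
  have hN0 : 0 ≤ N := l2norm_nonneg _
  have hNsq := l2norm_floorVec_sq X b w S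
  rw [← hN] at hNsq
  clear_value N
  have hbsum : ∑ j ∈ supp b \ S, b j ^ 2 ≤ s₂ * (4 * τ₀ ^ 2) := by
    refine (Finset.sum_le_card_nsmul _ _ (4 * τ₀ ^ 2) fun j hj => ?_).trans ?_
    · have := pow_le_pow_left₀ (abs_nonneg _) (hweak j (Finset.mem_sdiff.1 hj).2) 2
      rw [sq_abs] at this
      linarith
    · rw [Finset.card_sdiff_of_subset hSsub, ← hs, hcard, Nat.add_sub_cancel_left, nsmul_eq_mul]
  have hxsum : ∑ j ∈ S, effNoise X w j ^ 2 ≤ S.card * (64 * τ₀ ^ 2) := by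
    refine (Finset.sum_le_card_nsmul _ _ (64 * τ₀ ^ 2) fun j _ => hnoise j).trans ?_
    rw [nsmul_eq_mul]
  have hN8 : N ≤ 8 * (√s * τ₀) := by
    refine (sq_le_sq₀ hN0 (by positivity)).1 ?_
    have e : (8 * (√s * τ₀)) ^ 2 = s * (64 * τ₀ ^ 2) := by
      rw [mul_pow, mul_pow, Real.sq_sqrt (Nat.cast_nonneg _)]; ring
    rw [e, hNsq, hcard, Nat.cast_add]
    have : (0 : ℝ) ≤ s₂ * τ₀ ^ 2 := by positivity
    linarith
  set F := δ * N + δ * (p * (α ^ 2 / 2)) with hF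
  clear_value F
  have hFτ : F ≤ τ := by
    have h1 := mul_le_mul_of_nonneg_left hN8 hδ0
    have h2 : γ * τ₀ ≤ c₀ * τ := mul_le_mul hγc hτ₀τ hτ₀ hc0.le
    have h3 : (p * α) * (δ * α) ≤ c₀ * τ := mul_le_mul hpα hδτ (by positivity) hc0.le
    have h4 : c₀ * τ ≤ 1 / 256 * τ := mul_le_mul_of_nonneg_right hc1 hτ0
    have e1 : δ * (8 * (√s * τ₀)) = 8 * (γ * τ₀) := by rw [hγ]; ring
    have e2 : δ * (p * (α ^ 2 / 2)) = (p * α) * (δ * α) / 2 := by ring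
    rw [hF, e2]
    linarith
  have hsF : √s * F ≤ N / 2 + α / 2 := by
    have h1 : γ * N ≤ 1 / 2 * N := mul_le_mul_of_nonneg_right (by linarith) hN0
    have h2 : γ * (p * α) ≤ 1 * 1 := mul_le_mul (by linarith) (by linarith) (by positivity) zero_le_one
    have h3 := mul_le_mul_of_nonneg_right h2 hα.le
    have e : √s * F = γ * N + γ * (p * α) * α / 2 := by rw [hF, hγ]; ring
    rw [e]; linarith
  have hdecay : decay η m T₁ T ≤ (α / p) ^ 4 := by
    have hT₁T : T₁ ≤ T := by
      have : (T₁ : ℝ) ≤ T := by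
        refine le_of_mul_le_mul_right ?_ hηm0
        linarith
      exact_mod_cast this
    have h1 : 1 - η * m / 4 ≤ Real.exp (-(η * m / 4)) := by
      linarith [Real.add_one_le_exp (-(η * m / 4))]
    calc decay η m T₁ T ≤ Real.exp (-(η * m / 4)) ^ (T - T₁) :=
          pow_le_pow_left₀ (by linarith) h1 _
      _ = Real.exp (-(((T : ℝ) - T₁) * (η * m)) / 4) := by
          rw [← Real.exp_nat_mul, Nat.cast_sub hT₁T]; congr 1; ring
      _ ≤ Real.exp ((4 : ℕ) * (-Λ)) := Real.exp_le_exp.2 (by push_cast; linarith)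
      _ = (α / p) ^ 4 := by rw [Real.exp_nat_mul, Real.exp_neg, hexpΛ, inv_div]
  have h256 : 256 * (1 + K) ≤ p / α := by
    rw [le_div_iff₀ hα]
    have := mul_le_mul_of_nonneg_left hαc (by linarith : 0 ≤ 1 + K)
    linarith
  have hit : 2 * R ≤ α ^ 2 * ((1 + η * m / 4) ^ (2 * T₁) - 1) :=
    two_mul_le_of_exp_growth hp1 hα (by linarith) hK.le hKm (by linarith) (by linarith) h256 hexpΛ
      (by linarith)
  have hηm1 : η * m ≤ 1 := by linarith
  have growth : 3 * η * ∑ r ∈ Finset.range T, (2 * τ₀ + 8 * τ₀ + 2 * F + γ * R * decay η m T₁ r) ≤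
      1 / 2 :=
    sum_growth_le hη hm hηm1 hγR0 (by linarith) hT2 hT₁u hγRΛ hγR hc1
  have H : Regime X b w S s δ α η m R N (8 * τ₀) (2 * τ₀) F T₁ T :=
    { rip := hX
      one_le_s := hs1
      card_supp := hs.ge
      δ_nonneg := hδ0
      α_pos := hα
      α_le := by linarith
      η_pos := hη
      m_pos := hm
      m_le := hmS
      le_R := hR
      m_le_R := hmR
      weak_le := hweak
      c_nonneg := by linarith
      c_le := by linarith
      noise_le := fun j => by
        refine (sq_le_sq₀ (abs_nonneg _) (by linarith)).1 ?_
        rw [sq_abs]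
        linarith [hnoise j]
      h_nonneg := by linarith
      floor_le := hN.ge
      F_eq := hF
      gap := by
        have := mul_le_mul_of_nonneg_right hc1 hm.le
        rw [← hγ]
        linarith
      small := by rw [← hγ]; linarith
      step := by linarith
      hit := hit
      growth := by rw [← hγ]; exact growth }
  have hmain := H.l2norm_sub_le
  have hKα : K * α ≤ 1 := by
    have := mul_le_mul_of_nonneg_left hαc hK.le
    linarith
  have hlast : √s * (R * decay η m T₁ T) ≤ α :=
    sqrt_mul_decay_le hp1 hsp hα (by linarith) hKα hR0.le hKm (H.decay_nonneg T) hdecay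
  have hoff : √p * (α ^ 2 / 2) ≤ α := sqrt_mul_sq_half_le hp1 hα (by linarith)
  -- `N`, then `2√s F ≤ N + α`, then `α` each for the transient and for the coordinates outside `S`.
  have hfin : l2norm (betaIter X (X *ᵥ b + w) α η T - b) ≤ 2 * N + 3 * α := by linarith
  have h9 := pow_le_pow_left₀ (l2norm_nonneg _) hfin 2
  refine h9.trans ?_
  linarith [sq_nonneg (2 * N - 3 * α)]

end HadamardGD

/-! ### Combining the deterministic bound with the noise event. -/

/-- `K` is the implied constant of `κ m ≲ 1`; `c₀` is the (sufficiently small) implied constant of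
the conditions on `δ`, `α` and `η`; `c₃` is the constant of the error bound. The upper end
`t ≤ c₂ / (η τ)` of the window is written as `t η τ ≤ c₂`, so that it is `+∞` when `τ = 0`. -/
theorem mainTheorem2 (K : ℝ) (hK : 0 < K) :
    ∃ c₀ c₁ c₂ c₃ c₄ c₅ : ℝ, 0 < c₀ ∧ 0 < c₁ ∧ 0 < c₂ ∧ 0 < c₃ ∧ 0 < c₄ ∧ 0 < c₅ ∧
      ∀ (n p : ℕ) (X : Matrix (Fin n) (Fin p) ℝ) (βs : Fin p → ℝ) (σ δ α η M : ℝ)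
        (s s₁ s₂ : ℕ) (m κ ε τ : ℝ),
        0 < n → 0 ≤ σ → 1 ≤ M →
        s = (HadamardGD.supp βs).card →
        s₁ = (HadamardGD.strong n σ βs).card →
        s₂ = (HadamardGD.weak n σ βs).card →
        m = HadamardGD.minStrong n σ βs →
        κ = HadamardGD.kappa n σ βs →
        ε = max (α ^ 2) (max (σ ^ 2 * (M * s₁ / n)) (σ ^ 2 * (s₂ * Real.log p / n))) →
        τ = max (δ * α) (σ * √(Real.log p / n)) →
        1 ≤ s₁ → s = s₁ + s₂ → κ * m ≤ K →
        HadamardGD.RIP X (s + 1) δ → δ ≤ c₀ / (κ * √s * Real.log (p / α)) →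
        0 < α → α ≤ c₀ / p →
        0 < η → η ≤ c₀ / (κ * Real.log (p / α)) →
        ∀ t : ℕ, c₁ * Real.log (p / α) / (η * m) ≤ t → t * (η * τ) ≤ c₂ →
        ∀ {Ω : Type*} [MeasurableSpace Ω] (P : Measure Ω) [IsProbabilityMeasure P]
          (w : Ω → Fin n → ℝ), HasLaw w (HadamardGD.noiseLaw n σ) P →
          1 - (p : ℝ) ^ (-c₄) - Real.exp (-c₅ * M * s) ≤
            P.real {ω | HadamardGD.l2norm
              (HadamardGD.betaIter X (X *ᵥ βs + w ω) α η t - βs) ^ 2 ≤ c₃ * ε} := by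
  refine ⟨1 / (256 * (1 + K)), 33, 1 / 144, 400, 1, 1, by positivity, by norm_num, by norm_num,
    by norm_num, one_pos, one_pos, ?_⟩
  intro n p X βs σ δ α η M s s₁ s₂ m κ ε τ hn hσ hM hs hs₁ hs₂ hm hκ hε hτ h1 hsum hKm hX hδ hα hαp
    hη hη' t ht1 ht2 Ω _ P _ w hw
  subst hs hs₁ hs₂
  obtain ⟨hm0, hmS⟩ := HadamardGD.minStrong_spec h1
  rw [← hm] at hm0 hmS
  have hR : ∀ j, |βs j| ≤ κ * m := by
    intro j
    rw [hκ, HadamardGD.kappa, ← hm, div_mul_cancel₀ _ hm0.ne']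
    exact HadamardGD.abs_le_theta_one βs j
  set S := HadamardGD.strong n σ βs with hS
  set s₂ := (HadamardGD.weak n σ βs).card with hs₂
  -- For `p = 1` the claimed probability is negative; `p = 0` is excluded by the existence of a
  -- strong signal.
  rcases Nat.lt_or_ge p 2 with hp | hp
  · have hp1 : p = 1 := by
      have : p ≠ 0 := by
        rintro rfl
        obtain ⟨j, _⟩ := Finset.card_pos.1 h1
        exact j.elim0
      omega
    have : (p : ℝ) ^ (-1 : ℝ) = 1 := by rw [hp1]; simp
    rw [this]
    have h2 := Real.exp_pos (-1 * M * (HadamardGD.supp βs).card)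
    have h3 := measureReal_nonneg (μ := P) (s := {ω | HadamardGD.l2norm
              (HadamardGD.betaIter X (X *ᵥ βs + w ω) α η t - βs) ^ 2 ≤ 400 * ε})
    linarith
  have hn' : (0 : ℝ) < n := Nat.cast_pos.2 hn
  have hp' : (2 : ℝ) ≤ p := by exact_mod_cast hp
  have hL0 : 0 < Real.log p := Real.log_pos (by linarith)
  set τ₀ := σ * √(Real.log p / n) with hτ₀
  have hτ₀sq : τ₀ ^ 2 = σ ^ 2 * (Real.log p / n) := by
    rw [hτ₀, mul_pow, Real.sq_sqrt (by positivity)]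
  have hSsub : S.card ≤ (HadamardGD.supp βs).card + 1 := by omega
  -- Non-strict inequalities, so that scaling the standard Gaussian event by `σ` also covers `σ =
  -- 0`.
  set good := {v : Fin n → ℝ | (∀ j, HadamardGD.effNoise X v j ^ 2 ≤ 64 * τ₀ ^ 2) ∧
    ∑ j ∈ S, HadamardGD.effNoise X v j ^ 2 ≤
      16 * (σ ^ 2 * ((M * S.card + s₂ * Real.log p) / n))} with hgood
  have hmeas : MeasurableSet good := by
    have h1 : MeasurableSet {v : Fin n → ℝ | ∀ j, HadamardGD.effNoise X v j ^ 2 ≤ 64 * τ₀ ^ 2} := by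
      have : {v : Fin n → ℝ | ∀ j, HadamardGD.effNoise X v j ^ 2 ≤ 64 * τ₀ ^ 2} =
          ⋂ j, {v | HadamardGD.effNoise X v j ^ 2 ≤ 64 * τ₀ ^ 2} := by ext; simp
      rw [this]
      exact MeasurableSet.iInter fun j =>
        measurableSet_le ((HadamardGD.measurable_effNoise X j).pow_const 2) measurable_const
    exact h1.inter (measurableSet_le
      (Finset.measurable_fun_sum _ fun j _ => (HadamardGD.measurable_effNoise X j).pow_const 2)
      measurable_const)
  have hδ1 : δ ≤ 1 := by
    obtain ⟨j, hj⟩ := Finset.card_pos.1 h1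
    have hκ1 : 1 ≤ κ := le_of_mul_le_mul_right
      (by rw [one_mul]; exact (hmS j hj).trans (hR j)) hm0
    have hc : 1 / (256 * (1 + K)) ≤ 1 / 256 :=
      one_div_le_one_div_of_le (by norm_num) (by linarith)
    have hpα : 256 ≤ p / α := by
      rw [le_div_iff₀ (by linarith)] at hαp
      rw [le_div_iff₀ hα]
      nlinarith
    have hΛ : 1 ≤ Real.log (p / α) := by
      rw [Real.le_log_iff_exp_le (by linarith)]
      linarith [Real.exp_one_lt_d9]
    have hsq : 1 ≤ √((HadamardGD.supp βs).card : ℝ) :=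
      Real.one_le_sqrt.2 (by exact_mod_cast (by omega : 1 ≤ (HadamardGD.supp βs).card))
    refine hδ.trans ((div_le_self (by positivity) ?_).trans (hc.trans (by norm_num)))
    exact one_le_mul_of_one_le_of_one_le (one_le_mul_of_one_le_of_one_le hκ1 hsq) hΛ
  have hprob : 1 - (p : ℝ)⁻¹ - Real.exp (-(M * (S.card + s₂ : ℕ))) ≤ P.real {ω | w ω ∈ good} := by
    have e : P.real {ω | w ω ∈ good} = (HadamardGD.noiseLaw n σ).real good :=
      hw.measureReal_eq (p := fun v => v ∈ good) hmeas
    rw [e]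
    refine (hX.effNoise_good hδ1 hn hp hSsub h1 hM (s₂ := s₂)).trans ?_
    rw [HadamardGD.noiseLaw_eq_map, map_measureReal_apply (by fun_prop) hmeas]
    refine measureReal_mono fun z hz => ⟨fun j => ?_, ?_⟩
    · rw [HadamardGD.effNoise_const_mul, mul_pow, hτ₀sq]
      have := mul_le_mul_of_nonneg_left (hz.1 j).le (sq_nonneg σ)
      linarith
    · simp_rw [HadamardGD.effNoise_const_mul, mul_pow]
      rw [← Finset.mul_sum]
      have := mul_le_mul_of_nonneg_left hz.2.le (sq_nonneg σ)
      linarith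
  have e1 : (p : ℝ) ^ (-1 : ℝ) = (p : ℝ)⁻¹ := Real.rpow_neg_one _
  have e2 : -1 * M * ((HadamardGD.supp βs).card : ℝ) = -(M * (S.card + s₂ : ℕ)) := by
    rw [hsum]; ring
  rw [e1, e2]
  refine hprob.trans (measureReal_mono fun ω hω => ?_)
  have hε1 : α ^ 2 ≤ ε := hε ▸ le_max_left _ _
  have hε2 : σ ^ 2 * (M * S.card / n) ≤ ε := hε ▸ (le_max_left _ _).trans (le_max_right _ _)
  have hε3 : σ ^ 2 * (s₂ * Real.log p / n) ≤ ε := hε ▸ (le_max_right _ _).trans (le_max_right _ _)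
  have hmain := HadamardGD.error_le hK h1 hsum hm0 hmS hR hKm
    (fun j hj => HadamardGD.abs_le_of_notMem_strong hσ hsum hj) (by positivity)
    (hτ ▸ le_max_right _ _) (hτ ▸ le_max_left _ _) hω.1 hX hδ hα hαp hη hη' ht1 ht2
  refine hmain.trans ?_
  have h5 := hω.2
  rw [← hτ₀, hτ₀sq]
  have e3 : 16 * (σ ^ 2 * ((M * S.card + s₂ * Real.log p) / n)) =
    16 * (σ ^ 2 * (M * S.card / n)) + 16 * (σ ^ 2 * (s₂ * Real.log p / n)) := by ring
  have e4 : s₂ * (4 * (σ ^ 2 * (Real.log p / n))) = 4 * (σ ^ 2 * (s₂ * Real.log p / n)) := by ring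
  rw [e4]
  -- The total is `8·16 + 8·(16 + 4) + 18 = 306 ≤ 400` times `ε`.
  linarith [sq_nonneg α]
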